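/- **Setting.** All spaces are complex. Let $X,Z,U,Y$ be Banach spaces, $W$ a Hilbert space, and $\alpha\ge 0$. For an operator $A$ generating a strongly continuous semigroup on $X$ and $\lambda_0\in\rho(A)$, let $X_1=(\mathrm{Dom}(A),\|(\lambda_0-A)\cdot\|)$, let $X_{-1}$ be the completion of $X$ in the norm $\|R(\lambda_0,A)\cdot\|$, where $R(\lambda,A)=(\lambda-A)^{-1}$, and let $A_{-1}:X\subset X_{-1}\to X_{-1}$ be the continuous extension of $A$. *Exosystem.* Let $I$ be a countable index set (in particular $I=\mathbb Z$, or $I$ finite for a finite-dimensional exosystem), $\omega_k\in\mathbb R$ and $n_k\ge 1$ for $k\in I$, with $\sup_k n_k<\infty$, and let $\{\phi_k^l: k\in I,\ 1\le l\le n_k\}$ be an orthonormal basis of $W$. Put $P_k=\sum_{l}\langle\cdot,\phi_k^l\rangle\phi_k^l$, $S_k=i\omega_k\langle\cdot,\phi_k^1\rangle\phi_k^1+\sum_{l\ge2}\langle\cdot,\phi_k^l\rangle(i\omega_k\phi_k^l+\phi_k^{l-1})$, $Sv=\sum_kS_kv$ with $\mathrm{Dom}(S)=\{v:\sum_k\|S_kv\|^2<\infty\}$,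 and let $T_S(t)v=\sum_k e^{i\omega_kt}\sum_{l}\langle v,\phi_k^l\rangle\sum_{j\le l}\frac{t^{l-j}}{(l-j)!}\phi_k^j$ be the group generated by $S$. For $\beta\ge0$ let $W_\beta=\{v\in W:\|v\|_\beta^2=\sum_k(1+\omega_k^2)^\beta\|P_kv\|^2<\infty\}$. *Plant and controller.* A plant $(A,B,C,D)$ consists of a generator $A$ of a strongly continuous semigroup on $X$, $B\in\mathcal L(U,X_{-1})$, a linear operator $C:\mathrm{Dom}(C)\subset X\to Y$ with $\mathrm{Dom}(A)\subset\mathrm{Dom}(C)$ whose restriction is in $\mathcal L(X_1,Y)$, and $D\in\mathcal L(U,Y)$, such that for some $\lambda\in\rho(A)$ one has $\mathrm{ran}(R(\lambda,A_{-1})B)\subset\mathrm{Dom}(C)$ and $CR(\lambda,A_{-1})B\in\mathcal L(U,Y)$. Let also $E\in\mathcal L(W,X)$ and $F\in\mathcal L(W,Y)$. A controller $(\mathcal G_1,\mathcal G_2,K)$ consists of a generator $\mathcal G_1$ of a strongly continuous semigroup on $Z$, $\mathcal G_2\in\mathcal L(Y,Z)$, and a linear operator $K:\mathrm{Dom}(K)\subset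 Z\to U$ with $\mathrm{Dom}(\mathcal G_1)\subset\mathrm{Dom}(K)$ that is bounded from $\mathrm{Dom}(\mathcal G_1)$ with the graph norm to $U$. *Closed loop.* On $X_e=X\times Z$ let $$A_e=\begin{pmatrix}A_{-1}&BK\\ \mathcal G_2C&\mathcal G_1+\mathcal G_2DK\end{pmatrix},\qquad \mathrm{Dom}(A_e)=\{(x,z)\in\mathrm{Dom}(C)\times\mathrm{Dom}(\mathcal G_1): A_{-1}x+BKz\in X\},$$ $B_e=(E,\mathcal G_2F)^T$, $C_e=(C,\ DK)$ with domain $\mathrm{Dom}(C)\times\mathrm{Dom}(K)$, $D_e=F$. It is assumed that $A_e$ generates a strongly continuous semigroup $T_e(t)$ and that $C_e$ is $A_e$-bounded. The regulation error for the initial data $x_{e0},v_0$ is $e(t)=C_ex_e(t)+D_eT_S(t)v_0$ with $x_e(t)=T_e(t)x_{e0}+\int_0^tT_e(t-s)B_eT_S(s)v_0\,ds$. A semigroup $T(t)$ is strongly stable if $T(t)x\to0$ as $t\to\infty$ for all $x$. The controller *solves the output regulation problem* if $T_e(t)$ is strongly stable and, for all $x_{e0}\in\mathrm{Dom}(A_e)$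 and $v_0\in W_{\alpha+1}$, the error $e(t)$ is defined for all $t\ge 0$ and $e(t)\to0$ as $t\to\infty$. *Perturbations.* The perturbed operators $(\tilde A,\tilde B,\tilde C,\tilde D,\tilde E,\tilde F)$ belong to the class $\mathcal O$; this means that $(\tilde A,\tilde B,\tilde C,\tilde D)$ is a plant as above on the same spaces (with the scale spaces of $\tilde A$), $\tilde E\in\mathcal L(W,X)$, $\tilde F\in\mathcal L(W,Y)$, $i\omega_k\in\rho(\tilde A)$ for all $k$, the perturbed closed-loop operator $\tilde A_e$ (with its maximal domain) generates a strongly stable strongly continuous semigroup, $\tilde C_e$ is $\tilde A_e$-bounded, and there is $\Sigma\in\mathcal L(W_\alpha,X_e)$ with $\Sigma(W_{\alpha+1})\subset\mathrm{Dom}(\tilde A_e)$ and $\Sigma S=\tilde A_e\Sigma+\tilde B_e$ on $W_{\alpha+1}$. The controller is *robust with respect to these perturbations* if in the perturbed closed-loop system, for all $x_{e0}\in\mathrm{Dom}(\tilde A_e)$ and $v_0\in W_{\alpha+1}$, the error $e(t)$ is defined for all $t\ge 0$ and $e(t)\to0$ as $t\to\infty$. *Block operators.* Let $\Phi_k=(\phi_k^{n_k},\dots,\phi_k^1)^T$.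 Let $\mathbb R(i\omega_k,\tilde A)$ be the block upper triangular $n_k\times n_k$ operator matrix on $X^{n_k}$ with entries $(-1)^{j-i}R(i\omega_k,\tilde A)^{j-i+1}$, $i\le j$, define $\mathbb R(i\omega_k,\tilde A_{-1})$ in the same way, and let $\tilde{\mathbb P}(i\omega_k)=\tilde C\,\mathbb R(i\omega_k,\tilde A_{-1})\tilde B+\tilde D$, where $\tilde B,\tilde C,\tilde D$ (and $K,\tilde E,\tilde F$ below) act componentwise. Let $J_{\mathcal G}$ be the block upper triangular operator on $\mathrm{Dom}(\mathcal G_1)^{n_k}$ with $i\omega_k-\mathcal G_1$ on the diagonal, identity operators on the first superdiagonal, and zeros elsewhere. **Theorem.** Let the controller $(\mathcal G_1,\mathcal G_2,K)$ solve the output regulation problem for $(A,B,C,D,E,F)$, and let $(\tilde A,\tilde B,\tilde C,\tilde D,\tilde E,\tilde F)\in\mathcal O$. The controller is robust with respect to these perturbations if and only if for every $k\in I$ the equations $$\tilde{\mathbb P}(i\omega_k)K\vec z^{\,k}=-\tilde C\,\mathbb R(i\omega_k,\tilde A)\tilde E\Phi_k-\tilde F\Phi_k,\qquad J_{\mathcal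 G}\vec z^{\,k}=0$$ have a solution $\vec z^{\,k}=(z^k_{n_k},\dots,z^k_1)^T\in\mathrm{Dom}(\mathcal G_1)^{n_k}$. Moreover, for every $k\in I$ these equations have at most one solution in $\mathrm{Dom}(\mathcal G_1)^{n_k}$. -/

import Mathlib

namespace OutputRegulation

open Filter Topology

noncomputable section

/-! ### Unbounded operators, resolvents and semigroups -/

section Operators

variable {X V Y : Type*}
  [NormedAddCommGroup X] [NormedSpace ℂ X]
  [NormedAddCommGroup V] [NormedSpace ℂ V]
  [NormedAddCommGroup Y] [NormedSpace ℂ Y]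

/-- The value `f x` of a partially defined operator. The value `0` outside `Dom(f)` is a default
that is never used: below, `pval f x` only occurs for `x` in the domain of `f`. -/
def pval (f : X →ₗ.[ℂ] Y) (x : X) : Y := by
  classical
  exact if h : x ∈ f.domain then f ⟨x, h⟩ else 0

/-- `R` is the bounded two-sided inverse of `lam - A : Dom(A) → X`. -/
def IsResolventAt (A : X →ₗ.[ℂ] X) (lam : ℂ) (R : X →L[ℂ] X) : Prop :=
  (∀ x : X, ∃ h : R x ∈ A.domain, lam • R x - A ⟨R x, h⟩ = x) ∧
  (∀ x : A.domain, R (lam • (x : X) - A x) = x)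

/-- The resolvent set `ρ(A)`. -/
def resolventSet (A : X →ₗ.[ℂ] X) : Set ℂ :=
  {lam | ∃ R : X →L[ℂ] X, IsResolventAt A lam R}

/-- The resolvent `R(lam, A) = (lam - A)⁻¹` for `lam ∈ ρ(A)` (and `0` by default otherwise). -/
def resolvent (A : X →ₗ.[ℂ] X) (lam : ℂ) : X →L[ℂ] X := by
  classical
  exact if h : ∃ R : X →L[ℂ] X, IsResolventAt A lam R then h.choose else 0

/-- Strongly continuous semigroups of bounded operators (only the times `t ≥ 0` matter). -/
structure C0Semigroup (X : Type*) [NormedAddCommGroup X] [NormedSpace ℂ X] where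
  /-- The operators of the semigroup. -/
  toFun : ℝ → X →L[ℂ] X
  map_zero : toFun 0 = ContinuousLinearMap.id ℂ X
  map_add : ∀ s t : ℝ, 0 ≤ s → 0 ≤ t → toFun (s + t) = (toFun s).comp (toFun t)
  strongly_continuous : ∀ x : X, Tendsto (fun t => toFun t x) (𝓝[>] 0) (𝓝 x)

/-- `A`, with its given domain, is the infinitesimal generator of the semigroup `T`:
`x ∈ Dom(A)` and `A x = y` if and only if `(T(t) x - x) / t → y` as `t → 0+`. -/
def C0Semigroup.IsGeneratedBy (T : C0Semigroup X) (A : X →ₗ.[ℂ] X) : Prop :=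
  ∀ x y : X, (x, y) ∈ A.graph ↔
    Tendsto (fun t : ℝ => ((t⁻¹ : ℝ) : ℂ) • (T.toFun t x - x)) (𝓝[>] 0) (𝓝 y)

/-- Strong stability: `T(t) x → 0` as `t → ∞` for every `x`. -/
def C0Semigroup.StronglyStable (T : C0Semigroup X) : Prop :=
  ∀ x : X, Tendsto (fun t => T.toFun t x) atTop (𝓝 0)

/-- `C` is relatively bounded with respect to `A` (`A`-bounded). -/
def RelativelyBounded (A : X →ₗ.[ℂ] V) (C : X →ₗ.[ℂ] Y) : Prop :=
  A.domain ≤ C.domain ∧ ∃ a b : ℝ, ∀ x ∈ A.domain, ‖pval C x‖ ≤ a * ‖x‖ + b * ‖pval A x‖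

/-- `C` restricts to a bounded operator on the scale space
`X₁ = (Dom(A), ‖(lam - A) ·‖)`, i.e. `C ∈ ℒ(X₁, Y)`. -/
def BoundedOnScaleSpace (A : X →ₗ.[ℂ] X) (lam : ℂ) (C : X →ₗ.[ℂ] Y) : Prop :=
  A.domain ≤ C.domain ∧ ∃ M : ℝ, ∀ x ∈ A.domain, ‖pval C x‖ ≤ M * ‖lam • x - pval A x‖

end Operators

/-! ### The extrapolation space `X₋₁` -/

section Extrapolation

variable {X : Type*} [NormedAddCommGroup X] [NormedSpace ℂ X]

/-- The vector space `X`, to be equipped with the norm `‖R(lam, A) ·‖`. -/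
def PreExtrapolation {X : Type*} [NormedAddCommGroup X] [NormedSpace ℂ X]
    (_A : X →ₗ.[ℂ] X) (_lam : ℂ) : Type _ := X

instance (A : X →ₗ.[ℂ] X) (lam : ℂ) : AddCommGroup (PreExtrapolation A lam) :=
  inferInstanceAs (AddCommGroup X)

instance (A : X →ₗ.[ℂ] X) (lam : ℂ) : Module ℂ (PreExtrapolation A lam) :=
  inferInstanceAs (Module ℂ X)

/-- The identity map of `X`, with target `X` normed by `‖R(lam, A) ·‖`. -/
def toPre (A : X →ₗ.[ℂ] X) (lam : ℂ) : X ≃ₗ[ℂ] PreExtrapolation A lam :=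
  LinearEquiv.refl ℂ X

/-- The map `R(lam, A)` on `PreExtrapolation A lam`. -/
def preResolvent (A : X →ₗ.[ℂ] X) (lam : ℂ) : PreExtrapolation A lam →ₗ[ℂ] X :=
  (resolvent A lam).toLinearMap.comp (toPre A lam).symm.toLinearMap

instance (A : X →ₗ.[ℂ] X) (lam : ℂ) : SeminormedAddCommGroup (PreExtrapolation A lam) :=
  SeminormedAddCommGroup.induced (PreExtrapolation A lam) X (preResolvent A lam)

instance (A : X →ₗ.[ℂ] X) (lam : ℂ) : NormedSpace ℂ (PreExtrapolation A lam) :=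
  NormedSpace.induced ℂ (PreExtrapolation A lam) X (preResolvent A lam)

theorem norm_toPre (A : X →ₗ.[ℂ] X) (lam : ℂ) (x : X) :
    ‖toPre A lam x‖ = ‖resolvent A lam x‖ := rfl

/-- The space `X₋₁`: the completion of `X` with respect to the norm `‖R(lam, A) ·‖`. -/
abbrev Extrapolation (A : X →ₗ.[ℂ] X) (lam : ℂ) : Type _ :=
  UniformSpace.Completion (PreExtrapolation A lam)

/-- The canonical embedding `X → X₋₁`. -/
def embed (A : X →ₗ.[ℂ] X) (lam : ℂ) : X →L[ℂ] Extrapolation A lam :=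
  LinearMap.mkContinuous
    ((UniformSpace.Completion.toComplL (𝕜 := ℂ) (E := PreExtrapolation A lam)).toLinearMap.comp
      (toPre A lam).toLinearMap)
    ‖resolvent A lam‖
    (fun x => by
      have h : ‖((toPre A lam x : PreExtrapolation A lam) : Extrapolation A lam)‖
          = ‖toPre A lam x‖ := UniformSpace.Completion.norm_coe _
      simpa [h, norm_toPre] using (resolvent A lam).le_opNorm x)

/-- `A₋₁ : X ⊂ X₋₁ → X₋₁`, the continuous extension of `A : Dom(A) ⊂ X → X ⊂ X₋₁` to its domain
`X` (with `X` carrying its own norm). -/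
def extendedGenerator (A : X →ₗ.[ℂ] X) (lam : ℂ) : X →L[ℂ] Extrapolation A lam :=
  ((embed A lam).toLinearMap.comp A.toFun).extendOfNorm A.domain.subtype

/-- The resolvent `R(mu, A₋₁) = (mu - A₋₁)⁻¹` on `X₋₁`, with values in `Dom(A₋₁) = X`. -/
def extendedResolvent (A : X →ₗ.[ℂ] X) (lam mu : ℂ) : Extrapolation A lam →L[ℂ] X :=
  (mu • embed A lam - extendedGenerator A lam).inverse

/-- The power `R(mu, A₋₁) ^ (m + 1)` on `X₋₁`, with values in `X`. -/
def extendedResolventPow (A : X →ₗ.[ℂ] X) (lam mu : ℂ) (m : ℕ) : Extrapolation A lam →L[ℂ] X :=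
  (extendedResolvent A lam mu).comp (((embed A lam).comp (extendedResolvent A lam mu)) ^ m)

end Extrapolation

/-! ### The exosystem -/

/-- The data of a block diagonal exosystem: frequencies `ω k`, block sizes `n k`, and an
orthonormal basis `φ k l` of the Hilbert space `W`. Here `φ k l` with `l : Fin (n k)` is the
basis vector whose one-based upper index is `l + 1`. -/
structure Exosystem (I W : Type*) [NormedAddCommGroup W] [InnerProductSpace ℂ W] where
  /-- The frequencies. -/
  ω : I → ℝ
  /-- The block sizes. -/
  n : I → ℕ
  n_pos : ∀ k, 1 ≤ n k
  n_bounded : ∃ N : ℕ, ∀ k, n k ≤ N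
  /-- The orthonormal basis. -/
  basis : HilbertBasis (Σ k : I, Fin (n k)) ℂ W

namespace Exosystem

variable {I W : Type*} [NormedAddCommGroup W] [InnerProductSpace ℂ W] (S : Exosystem I W)

/-- The basis vector `φ k l`. -/
def φ (k : I) (l : Fin (S.n k)) : W := S.basis ⟨k, l⟩

/-- The number `i ω k`. -/
def freq (k : I) : ℂ := Complex.I * (S.ω k : ℂ)

/-- The orthogonal projection onto the span of `φ k l`, `l = 1, …, n k`. -/
def proj (k : I) : W →ₗ[ℂ] W :=
  ∑ l : Fin (S.n k), (innerₛₗ ℂ (S.φ k l)).smulRight (S.φ k l)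

/-- The value of the Jordan block at a basis vector: `i ω φ¹` for `l = 1`, and
`i ω φˡ + φˡ⁻¹` for `l ≥ 2`. -/
def blockVec (k : I) (l : Fin (S.n k)) : W :=
  S.freq k • S.φ k l + if 0 < (l : ℕ) then S.φ k ⟨l - 1, by omega⟩ else 0

/-- The Jordan block `S k`. -/
def block (k : I) : W →ₗ[ℂ] W :=
  ∑ l : Fin (S.n k), (innerₛₗ ℂ (S.φ k l)).smulRight (S.blockVec k l)

theorem block_apply (k : I) (v : W) :
    S.block k v = ∑ l : Fin (S.n k), inner ℂ (S.φ k l) (v) • S.blockVec k l := by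
  simp [block]

theorem inner_φ_of_ne {k j : I} (h : k ≠ j) (l : Fin (S.n k)) (m : Fin (S.n j)) :
    inner ℂ (S.φ k l) (S.φ j m) = 0 :=
  S.basis.orthonormal.2 (fun e => h (congrArg Sigma.fst e))

theorem inner_blockVec_of_ne {k j : I} (h : k ≠ j) (l : Fin (S.n k)) (m : Fin (S.n j)) :
    inner ℂ (S.blockVec k l) (S.blockVec j m) = 0 := by
  unfold blockVec
  split_ifs <;>
    simp [S.inner_φ_of_ne h]

theorem inner_block_of_ne {k j : I} (h : k ≠ j) (v w : W) :
    inner ℂ (S.block k v) (S.block j w) = 0 := by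
  simp [block_apply, S.inner_blockVec_of_ne h]

theorem orthogonalFamily_block :
    OrthogonalFamily ℂ (fun k => LinearMap.range (S.block k))
      (fun k => (LinearMap.range (S.block k)).subtypeₗᵢ) := by
  rintro k j h ⟨_, v, rfl⟩ ⟨_, w, rfl⟩
  exact S.inner_block_of_ne h v w

theorem summable_block [CompleteSpace W] {v : W} (hv : Summable fun k => ‖S.block k v‖ ^ 2) :
    Summable fun k => S.block k v :=
  (S.orthogonalFamily_block.summable_iff_norm_sq_summable
    (fun k => ⟨S.block k v, v, rfl⟩)).2 hv

theorem summable_norm_sq_add {I W : Type*} [NormedAddCommGroup W] {f g : I → W} (hf : Summable fun k => ‖f k‖ ^ 2)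
    (hg : Summable fun k => ‖g k‖ ^ 2) : Summable fun k => ‖f k + g k‖ ^ 2 := by
  refine Summable.of_nonneg_of_le (fun k => sq_nonneg _) (fun k => ?_)
    ((hf.mul_left 2).add (hg.mul_left 2))
  have h1 := norm_add_le (f k) (g k)
  have h2 := norm_nonneg (f k + g k)
  nlinarith [sq_nonneg (‖f k‖ - ‖g k‖)]

/-- The system operator: `S v = ∑ₖ S k v` on the domain of all `v` with `∑ₖ ‖S k v‖² < ∞`. -/
def op [CompleteSpace W] : W →ₗ.[ℂ] W where
  domain :=
    { carrier := {v | Summable fun k => ‖S.block k v‖ ^ 2}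
      add_mem' := fun {v w} hv hw => by
        simpa only [Set.mem_ofPred_eq, map_add] using summable_norm_sq_add hv hw
      zero_mem' := by simp [summable_zero]
      smul_mem' := fun c v hv => by
        simpa only [Set.mem_ofPred_eq, map_smul, norm_smul, mul_pow] using
          Summable.mul_left (‖c‖ ^ 2) hv }
  toFun :=
    { toFun := fun v => ∑' k, S.block k v
      map_add' := fun v w => by
        simpa only [Submodule.coe_add, map_add] using
          (S.summable_block v.2).tsum_add (S.summable_block w.2)
      map_smul' := fun c v => by
        simpa only [SetLike.val_smul, map_smul, RingHom.id_apply] using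
          (S.summable_block v.2).tsum_const_smul c }

/-- The group `T_S(t)` generated by the system operator:
`T_S(t) v = ∑ₖ e^{i ωₖ t} ∑ₗ ⟨v, φₖˡ⟩ ∑_{j ≤ l} t^{l-j} / (l-j)! φₖʲ`. -/
def group (t : ℝ) (v : W) : W :=
  ∑' k, Complex.exp (S.freq k * t) • ∑ l : Fin (S.n k), inner ℂ (S.φ k l) (v) •
    ∑ j ∈ Finset.Iic l, ((t : ℂ) ^ ((l : ℕ) - j) / (((l : ℕ) - j).factorial : ℂ)) • S.φ k j

/-- The space `W_α`. -/
def scale (α : ℝ) : Submodule ℂ W where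
  carrier := {v | Summable fun k => (1 + S.ω k ^ 2) ^ α * ‖S.proj k v‖ ^ 2}
  add_mem' := fun {v w} hv hw => by
    have key : ∀ (k : I) (x : W), (1 + S.ω k ^ 2) ^ α * ‖S.proj k x‖ ^ 2 =
        ‖(((1 + S.ω k ^ 2) ^ (α / 2) : ℝ) : ℂ) • S.proj k x‖ ^ 2 := by
      intro k x
      have hp : (0 : ℝ) < 1 + S.ω k ^ 2 := by positivity
      rw [norm_smul, Complex.norm_real, mul_pow, Real.norm_eq_abs, sq_abs,
        ← Real.rpow_natCast ((1 + S.ω k ^ 2) ^ (α / 2)) 2, ← Real.rpow_mul hp.le]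
      norm_num
    simp only [Set.mem_ofPred_eq, key, map_add, smul_add] at hv hw ⊢
    exact summable_norm_sq_add hv hw
  zero_mem' := by simp [summable_zero]
  smul_mem' := fun c v hv => by
    have h := Summable.mul_left (‖c‖ ^ 2) hv
    simp only [Set.mem_ofPred_eq, map_smul, norm_smul, mul_pow]
    exact h.congr fun k => by ring

/-- The norm `‖·‖_α` of the space `W_α`. -/
def scaleNorm (α : ℝ) (v : W) : ℝ :=
  Real.sqrt (∑' k, (1 + S.ω k ^ 2) ^ α * ‖S.proj k v‖ ^ 2)

/-- The vector `Φ_k = (φ_k^{n_k}, …, φ_k^1)`. -/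
def Φ (k : I) (i : Fin (S.n k)) : W := S.φ k i.rev

end Exosystem

/-! ### Plant, controller and closed-loop system -/

/-- The operators `(A, B, C, D)` of the plant; `B` takes values in `X₋₁`, formed with the
point `lam`. -/
structure Plant (X U Y : Type*) [NormedAddCommGroup X] [NormedSpace ℂ X]
    [NormedAddCommGroup U] [NormedSpace ℂ U] [NormedAddCommGroup Y] [NormedSpace ℂ Y] where
  /-- The system operator. -/
  A : X →ₗ.[ℂ] X
  /-- The point of the resolvent set which defines the norms of the scale spaces. -/
  lam : ℂ
  /-- The input operator. -/
  B : U →L[ℂ] Extrapolation A lam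
  /-- The output operator. -/
  C : X →ₗ.[ℂ] Y
  /-- The feedthrough operator. -/
  D : U →L[ℂ] Y

/-- The operators `(G₁, G₂, K)` of the dynamic error feedback controller; `K` is defined (at
least) on `Dom(G₁)`. -/
structure Controller (Z U Y : Type*) [NormedAddCommGroup Z] [NormedSpace ℂ Z]
    [NormedAddCommGroup U] [NormedSpace ℂ U] [NormedAddCommGroup Y] [NormedSpace ℂ Y] where
  /-- The system operator of the controller. -/
  G₁ : Z →ₗ.[ℂ] Z
  /-- The input operator of the controller. -/
  G₂ : Y →L[ℂ] Z
  /-- The output operator of the controller. -/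
  K : Z →ₗ.[ℂ] U
  dom_le : G₁.domain ≤ K.domain

section Systems

variable {X Z U Y W I : Type*}
  [NormedAddCommGroup X] [NormedSpace ℂ X]
  [NormedAddCommGroup Z] [NormedSpace ℂ Z]
  [NormedAddCommGroup U] [NormedSpace ℂ U]
  [NormedAddCommGroup Y] [NormedSpace ℂ Y]
  [NormedAddCommGroup W] [InnerProductSpace ℂ W]

/-- The assumptions on the plant: `A` generates a strongly continuous semigroup,
`C ∈ ℒ(X₁, Y)`, `ran(R(mu, A₋₁) B) ⊂ Dom(C)` and `C R(mu, A₋₁) B ∈ ℒ(U, Y)` for some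
`mu ∈ ρ(A)`. (`B ∈ ℒ(U, X₋₁)` and `D ∈ ℒ(U, Y)` are part of the data.) -/
structure Plant.IsAdmissible (P : Plant X U Y) : Prop where
  generates : ∃ T : C0Semigroup X, T.IsGeneratedBy P.A
  lam_mem : P.lam ∈ resolventSet P.A
  output_bounded : BoundedOnScaleSpace P.A P.lam P.C
  transfer_bounded : ∃ mu ∈ resolventSet P.A,
    (∀ u : U, extendedResolvent P.A P.lam mu (P.B u) ∈ P.C.domain) ∧
    ∃ M : ℝ, ∀ u : U, ‖pval P.C (extendedResolvent P.A P.lam mu (P.B u))‖ ≤ M * ‖u‖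

/-- The assumptions on the controller: `G₁` generates a strongly continuous semigroup and
`K ∈ ℒ(Z₁, U)`. -/
structure Controller.IsAdmissible (G : Controller Z U Y) : Prop where
  generates : ∃ T : C0Semigroup Z, T.IsGeneratedBy G.G₁
  output_bounded : ∃ mu ∈ resolventSet G.G₁, BoundedOnScaleSpace G.G₁ mu G.K

/-- The operator `K` on `Dom(G₁)`. -/
def Controller.KOnDom (G : Controller Z U Y) : G.G₁.domain →ₗ[ℂ] U :=
  G.K.toFun.comp (Submodule.inclusion G.dom_le)

/-- The graph of `A_e`: the pairs `((x, z), (w, q))` with `x ∈ Dom(C)`, `z ∈ Dom(G₁)`,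
`A₋₁ x + B K z = w ∈ X` and `q = G₂ C x + G₁ z + G₂ D K z`. -/
def closedLoopGraph (P : Plant X U Y) (G : Controller Z U Y) :
    Submodule ℂ ((X × Z) × (X × Z)) where
  carrier := {p | ∃ (x : P.C.domain) (z : G.G₁.domain), p.1 = ((x : X), (z : Z)) ∧
    extendedGenerator P.A P.lam x + P.B (G.KOnDom z) = embed P.A P.lam p.2.1 ∧
    p.2.2 = G.G₂ (P.C x) + (G.G₁ z + G.G₂ (P.D (G.KOnDom z)))}
  add_mem' := by
    rintro p q ⟨x, z, h1, h2, h3⟩ ⟨x', z', h1', h2', h3'⟩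
    refine ⟨x + x', z + z', by simp [h1, h1'], ?_, ?_⟩
    · rw [Prod.snd_add, Prod.fst_add, map_add (embed P.A P.lam), ← h2, ← h2']
      simp only [Submodule.coe_add, map_add]
      abel
    · rw [Prod.snd_add, Prod.snd_add, h3, h3', LinearPMap.map_add, LinearPMap.map_add]
      simp only [map_add]
      abel
  zero_mem' := ⟨0, 0, by simp; rfl, by simp, by simp⟩
  smul_mem' := by
    rintro c p ⟨x, z, h1, h2, h3⟩
    refine ⟨c • x, c • z, by simp [h1], ?_, ?_⟩
    · rw [Prod.smul_snd, Prod.smul_fst, map_smul (embed P.A P.lam), ← h2]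
      simp only [SetLike.val_smul, map_smul, smul_add]
    · rw [Prod.smul_snd, Prod.smul_snd, h3, LinearPMap.map_smul, LinearPMap.map_smul]
      simp only [map_smul, smul_add]

/-- The closed-loop system operator `A_e` on `X × Z`, with its maximal domain
`{(x, z) ∈ Dom(C) × Dom(G₁) | A₋₁ x + B K z ∈ X}`. -/
def closedLoopA (P : Plant X U Y) (G : Controller Z U Y) : (X × Z) →ₗ.[ℂ] (X × Z) :=
  (closedLoopGraph P G).toLinearPMap

/-- The operator `B_e = (E, G₂ F)`. -/
def closedLoopB (G : Controller Z U Y) (E : W →L[ℂ] X) (F : W →L[ℂ] Y) : W →L[ℂ] X × Z :=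
  E.prod (G.G₂.comp F)

/-- The operator `C_e = (C, D K)` with domain `Dom(C) × Dom(K)`. -/
def closedLoopC (P : Plant X U Y) (G : Controller Z U Y) : (X × Z) →ₗ.[ℂ] Y :=
  P.C.coprod (P.D.toLinearMap.compPMap G.K)

/-! ### Output regulation and robustness -/

/-- The mild state of the closed-loop system with semigroup `T`:
`x_e(t) = T(t) x_e0 + ∫₀ᵗ T(t - s) B_e T_S(s) v₀ ds`. -/
def closedLoopState (S : Exosystem I W) (T : C0Semigroup (X × Z)) (Be : W →L[ℂ] X × Z)
    (x₀ : X × Z) (v₀ : W) (t : ℝ) : X × Z :=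
  T.toFun t x₀ + ∫ s in (0 : ℝ)..t, T.toFun (t - s) (Be (S.group s v₀))

/-- For all `x_e0 ∈ Dom(A_e)` and `v₀ ∈ W_{α+1}` the regulation error
`e(t) = C_e x_e(t) + F v(t)` is defined for all `t ≥ 0` and `e(t) → 0` as `t → ∞`. Here `T` is
the semigroup generated by `A_e`. -/
def RegulationErrorVanishes (S : Exosystem I W) (α : ℝ) (P : Plant X U Y)
    (E : W →L[ℂ] X) (F : W →L[ℂ] Y) (G : Controller Z U Y) : Prop :=
  ∃ T : C0Semigroup (X × Z), T.IsGeneratedBy (closedLoopA P G) ∧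
    ∀ x₀ ∈ (closedLoopA P G).domain, ∀ v₀ ∈ S.scale (α + 1),
      (∀ t : ℝ, 0 ≤ t →
        closedLoopState S T (closedLoopB G E F) x₀ v₀ t ∈ (closedLoopC P G).domain) ∧
      Tendsto (fun t : ℝ =>
        pval (closedLoopC P G) (closedLoopState S T (closedLoopB G E F) x₀ v₀ t)
          + F (S.group t v₀)) atTop (𝓝 0)

/-- The closed-loop system operator generates a strongly stable strongly continuous semigroup. -/
def ClosedLoopStronglyStable (P : Plant X U Y) (G : Controller Z U Y) : Prop :=
  ∃ T : C0Semigroup (X × Z), T.IsGeneratedBy (closedLoopA P G) ∧ T.StronglyStable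

/-- The standing assumption on the closed-loop system: `A_e` generates a strongly continuous
semigroup and `C_e` is `A_e`-bounded. -/
def ClosedLoopWellPosed (P : Plant X U Y) (G : Controller Z U Y) : Prop :=
  (∃ T : C0Semigroup (X × Z), T.IsGeneratedBy (closedLoopA P G)) ∧
    RelativelyBounded (closedLoopA P G) (closedLoopC P G)

/-- The controller solves the output regulation problem: parts (a) and (b) of the robust output
regulation problem. -/
def SolvesOutputRegulation (S : Exosystem I W) (α : ℝ) (P : Plant X U Y)
    (E : W →L[ℂ] X) (F : W →L[ℂ] Y) (G : Controller Z U Y) : Prop :=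
  ClosedLoopStronglyStable P G ∧ RegulationErrorVanishes S α P E F G

/-- The controller is robust with respect to the perturbed operators `P = (A, B, C, D)`, `E`,
`F`: part (c) of the robust output regulation problem for these operators. -/
def RobustWithRespectTo (S : Exosystem I W) (α : ℝ) (G : Controller Z U Y) (P : Plant X U Y)
    (E : W →L[ℂ] X) (F : W →L[ℂ] Y) : Prop :=
  RegulationErrorVanishes S α P E F G

/-- The Sylvester equation `Sig S = A_e Sig + B_e` on `W_{α+1}` has a solution
`Sig ∈ ℒ(W_α, X × Z)` with `Sig (W_{α+1}) ⊂ Dom(A_e)`. -/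
def SylvesterSolvable [CompleteSpace W] (S : Exosystem I W) (α : ℝ)
    (Ae : (X × Z) →ₗ.[ℂ] (X × Z)) (Be : W →L[ℂ] X × Z) : Prop :=
  ∃ Sig : S.scale α →ₗ[ℂ] X × Z,
    (∃ M : ℝ, ∀ v : S.scale α, ‖Sig v‖ ≤ M * S.scaleNorm α v) ∧
    ∀ v ∈ S.scale (α + 1), ∃ (hS : v ∈ S.op.domain) (hv : v ∈ S.scale α)
      (hSv : S.op ⟨v, hS⟩ ∈ S.scale α) (hA : Sig ⟨v, hv⟩ ∈ Ae.domain),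
      Sig ⟨S.op ⟨v, hS⟩, hSv⟩ = Ae ⟨Sig ⟨v, hv⟩, hA⟩ + Be v

/-- The conditions on the perturbed operators in the class `𝒪` of considered perturbations. -/
structure IsInPerturbationClass [CompleteSpace W] (S : Exosystem I W) (α : ℝ)
    (G : Controller Z U Y) (P : Plant X U Y) (E : W →L[ℂ] X) (F : W →L[ℂ] Y) : Prop where
  plant_admissible : P.IsAdmissible
  freq_mem : ∀ k, S.freq k ∈ resolventSet P.A
  closedLoop_stable : ClosedLoopStronglyStable P G
  output_bounded : RelativelyBounded (closedLoopA P G) (closedLoopC P G)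
  sylvester : SylvesterSolvable S α (closedLoopA P G) (closedLoopB G E F)

/-! ### The block operators -/

/-- The block upper triangular operator with entry `(-1)^(j-i) c (j-i)` at position `(i, j)`,
`i ≤ j`. -/
def blockUpper {V V' : Type*} [AddCommGroup V'] (c : ℕ → V → V') (n : ℕ) (x : Fin n → V)
    (i : Fin n) : V' :=
  ∑ j ∈ Finset.Ici i, ((-1 : ℤ) ^ ((j : ℕ) - i)) • c ((j : ℕ) - i) (x j)

/-- The operator `ℝ(mu, A)` on `Xⁿ`, whose entries are `(-1)^(j-i) R(mu, A)^(j-i+1)`. -/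
def blockResolvent (A : X →ₗ.[ℂ] X) (mu : ℂ) (n : ℕ) : (Fin n → X) → Fin n → X :=
  blockUpper (fun m => ((resolvent A mu) ^ (m + 1) : X →L[ℂ] X)) n

/-- The operator `ℝ(mu, A₋₁)` on `(X₋₁)ⁿ`, with values in `Xⁿ`. -/
def blockExtendedResolvent (A : X →ₗ.[ℂ] X) (lam mu : ℂ) (n : ℕ) :
    (Fin n → Extrapolation A lam) → Fin n → X :=
  blockUpper (fun m => extendedResolventPow A lam mu m) n

/-- The operator `ℙ(mu) = C ℝ(mu, A₋₁) B + D` from `Uⁿ` to `Yⁿ`. -/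
def blockTransfer (P : Plant X U Y) (mu : ℂ) (n : ℕ) (u : Fin n → U) (i : Fin n) : Y :=
  pval P.C (blockExtendedResolvent P.A P.lam mu n (fun j => P.B (u j)) i) + P.D (u i)

/-- The operator `J_G`: block upper bidiagonal with `mu - G₁` on the diagonal and identity
operators on the first superdiagonal. -/
def jordanOp (G₁ : Z →ₗ.[ℂ] Z) (mu : ℂ) (n : ℕ) (z : Fin n → G₁.domain) (i : Fin n) : Z :=
  mu • (z i : Z) - G₁ (z i) + if h : (i : ℕ) + 1 < n then (z ⟨i + 1, h⟩ : Z) else 0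

/-- The vector `z = (z_n, …, z_1) ∈ Dom(G₁)ⁿ`, `n = n_k`, solves the equations
`ℙ(i ω_k) K z = - C ℝ(i ω_k, A) E Φ_k - F Φ_k` and `J_G z = 0`. -/
def SolvesBlockEquations (S : Exosystem I W) (G : Controller Z U Y) (P : Plant X U Y)
    (E : W →L[ℂ] X) (F : W →L[ℂ] Y) (k : I) (z : Fin (S.n k) → G.G₁.domain) : Prop :=
  (∀ i, blockTransfer P (S.freq k) (S.n k) (fun j => G.KOnDom (z j)) i =
    - pval P.C (blockResolvent P.A (S.freq k) (S.n k) (fun j => E (S.Φ k j)) i)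
      - F (S.Φ k i)) ∧
  (∀ i, jordanOp G.G₁ (S.freq k) (S.n k) z i = 0)

end Systems

end

end OutputRegulation

namespace OutputRegulation

open Filter Topology

noncomputable section

/-! ### Strongly continuous semigroups -/

section Pval

variable {X Y : Type*} [NormedAddCommGroup X] [NormedSpace ℂ X]
  [NormedAddCommGroup Y] [NormedSpace ℂ Y]

/-! The solution `Σ` of the perturbed Sylvester equation splits the closed-loop state into a
transient and a steady state, `x_e(t) = T_e(t)(x_e0 - Σ v₀) + Σ T_S(t) v₀`
(`IsSylvesterSolution.state_eq`). Both sides depend boundedly on `v₀ ∈ W_α`, so the identity need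
only be checked at basis vectors, where it is variation of constants along a Jordan chain
(`integral_chain`). Hence the error is `C_e T_e(t)(x_e0 - Σ v₀) + (C_e Σ + F) T_S(t) v₀`, and its
first term decays by strong stability and `A_e`-boundedness of `C_e`. The error therefore vanishes
for all data if and only if `C_e Σ + F` is zero at every basis vector. For necessity take `x_e0 = Σ
v₀` and go up each Jordan block: once the lower vectors are annihilated, what remains has constant
norm in time.

The rest is algebra in a single block. The Sylvester equation says that the vectors `Σ Φ_k` form an
inhomogeneous Jordan chain of `A_e` at `iω_k`. A strongly stable semigroup has no generator
eigenvalue on the imaginary axis, so such a chain is unique (`chain_unique`). Write its entries as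
`(x, z)`. The first row of the chain equation is equivalent to an explicit formula for `x` through
the block resolvents (`eq_block_iff`). If the error is zero along the chain, its second row becomes
`J_G z = 0`, and inserting the formula for `x` into the error gives the equation for `ℙ K z`. These
steps can be reversed (`exists_chain`, `of_chain`). Uniqueness of the chain then identifies every
solution `z` with the second components of `Σ Φ_k`, which gives both the missing implication and the
uniqueness claim. -/

theorem pval_of_mem (f : X →ₗ.[ℂ] Y) {x : X} (h : x ∈ f.domain) : pval f x = f ⟨x, h⟩ := by
  simp [pval, h]

theorem pval_add (f : X →ₗ.[ℂ] Y) {x y : X} (hx : x ∈ f.domain) (hy : y ∈ f.domain) :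
    pval f (x + y) = pval f x + pval f y := by
  rw [pval_of_mem f hx, pval_of_mem f hy, pval_of_mem f (f.domain.add_mem hx hy)]
  exact f.map_add ⟨x, hx⟩ ⟨y, hy⟩

theorem pval_smul (f : X →ₗ.[ℂ] Y) (c : ℂ) {x : X} (hx : x ∈ f.domain) :
    pval f (c • x) = c • pval f x := by
  rw [pval_of_mem f hx, pval_of_mem f (f.domain.smul_mem c hx)]
  exact f.map_smul c ⟨x, hx⟩

end Pval

namespace C0Semigroup

variable {X : Type*} [NormedAddCommGroup X] [NormedSpace ℂ X] (T : C0Semigroup X)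

theorem map_add_apply {s t : ℝ} (hs : 0 ≤ s) (ht : 0 ≤ t) (x : X) :
    T.toFun (s + t) x = T.toFun s (T.toFun t x) := by
  rw [T.map_add s t hs ht]; rfl

theorem map_zero_apply (x : X) : T.toFun 0 x = x := by
  rw [T.map_zero]; rfl

theorem tendsto_zero_right (x : X) : Tendsto (fun t => T.toFun t x) (𝓝[≥] 0) (𝓝 x) := by
  rw [← Set.Ioi_insert, nhdsWithin_insert, tendsto_sup]
  refine ⟨?_, T.strongly_continuous x⟩
  have := tendsto_pure_nhds (fun t => T.toFun t x) (0 : ℝ)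
  rwa [T.map_zero_apply] at this

/-- Otherwise the norms are unbounded along some sequence of times tending to zero. All orbits
converge along that sequence, so this contradicts the uniform boundedness principle. -/
theorem exists_norm_le_near_zero [CompleteSpace X] :
    ∃ δ > (0 : ℝ), ∃ M : ℝ, ∀ t, 0 ≤ t → t ≤ δ → ‖T.toFun t‖ ≤ M := by
  by_contra! h
  have h' : ∀ n : ℕ, ∃ t : ℝ, 0 ≤ t ∧ t ≤ 1 / ((n : ℝ) + 1) ∧ (n : ℝ) < ‖T.toFun t‖ :=
    fun n => h _ Nat.one_div_pos_of_nat n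
  choose t ht0 htn htM using h'
  have hlim : Tendsto t atTop (𝓝[≥] 0) := by
    refine tendsto_nhdsWithin_iff.2 ⟨?_, Eventually.of_forall ht0⟩
    exact squeeze_zero ht0 htn tendsto_one_div_add_atTop_nhds_zero_nat
  obtain ⟨C, hC⟩ := banach_steinhaus (g := fun n => T.toFun (t n)) (fun x => by
    obtain ⟨C, hC⟩ := ((T.tendsto_zero_right x).comp hlim).norm.bddAbove_range
    exact ⟨C, fun n => hC ⟨n, rfl⟩⟩)
  obtain ⟨n, hn⟩ := exists_nat_gt C
  exact absurd (htM n) (not_lt.2 ((hC n).trans hn.le))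

theorem exists_norm_le [CompleteSpace X] (b : ℝ) :
    ∃ M : ℝ, 0 ≤ M ∧ ∀ t, 0 ≤ t → t ≤ b → ‖T.toFun t‖ ≤ M := by
  obtain ⟨δ, hδ, M, hM⟩ := T.exists_norm_le_near_zero
  have hM0 : 0 ≤ M := (norm_nonneg _).trans (hM 0 le_rfl hδ.le)
  have key : ∀ n : ℕ, ∀ t, 0 ≤ t → t ≤ n * δ → ‖T.toFun t‖ ≤ M ^ n * (1 + M) := by
    intro n
    induction n with
    | zero =>
      intro t ht ht'
      have : t ≤ δ := by simp at ht'; linarith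
      simpa using (hM t ht this).trans (by linarith)
    | succ n ih =>
      intro t ht ht'
      push_cast at ht'
      rcases le_total t δ with h | h
      · have h1 : ‖T.toFun t‖ ≤ M := hM t ht h
        have h0 : ‖(T.toFun 0)‖ ≤ M := hM 0 le_rfl hδ.le
        -- The induction needs `1 ≤ M`. This follows from `T(0) = id` unless the space is trivial,
        -- and in that case `T(t) = 0`.
        rcases eq_or_ne (T.toFun t) 0 with hz | hz
        · rw [hz, norm_zero]; positivity
        · have : Nontrivial X := by
            by_contra hn
            rw [not_nontrivial_iff_subsingleton] at hn
            exact hz (Subsingleton.elim _ _)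
          have h2 : (1 : ℝ) ≤ M := by
            rwa [T.map_zero, ContinuousLinearMap.norm_id] at h0
          have h3 : (1 : ℝ) ≤ M ^ (n + 1) := one_le_pow₀ h2
          nlinarith
      · have e : T.toFun t = (T.toFun δ).comp (T.toFun (t - δ)) := by
          rw [← T.map_add δ (t - δ) hδ.le (by linarith)]; congr 1; ring
        rw [e]
        calc _ ≤ ‖T.toFun δ‖ * ‖T.toFun (t - δ)‖ := ContinuousLinearMap.opNorm_comp_le _ _
          _ ≤ M * (M ^ n * (1 + M)) := by
            gcongr
            · exact hM δ hδ.le le_rfl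
            · exact ih _ (by linarith) (by linarith)
          _ = _ := by ring
  obtain ⟨n, hn⟩ := exists_nat_gt (b / δ)
  refine ⟨M ^ n * (1 + M), by positivity, fun t ht hb => key n t ht ?_⟩
  rw [div_lt_iff₀ hδ] at hn
  linarith

/-- Continuity from either side reduces to right continuity at zero: up to sign, `T(s)x - T(t)x` is
`T(min s t)` applied to `T(|s - t|)x - x`, and the norms of the semigroup are bounded on compact
intervals. -/
theorem continuousOn_apply [CompleteSpace X] (x : X) :
    ContinuousOn (fun t => T.toFun t x) (Set.Ici 0) := by
  intro t ht
  have ht : 0 ≤ t := ht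
  obtain ⟨M, hM0, hM⟩ := T.exists_norm_le (t + 1)
  have hbound : ∀ s, 0 ≤ s → s ≤ t + 1 →
      ‖T.toFun s x - T.toFun t x‖ ≤ M * ‖T.toFun |s - t| x - x‖ := by
    intro s hs hst
    rcases le_total s t with h | h
    · have e : T.toFun t x = T.toFun s (T.toFun |s - t| x) := by
        rw [← T.map_add_apply hs (abs_nonneg _), abs_of_nonpos (by linarith)]; congr 2; ring
      rw [e, ← map_sub, norm_sub_rev (T.toFun |s - t| x)]
      exact ContinuousLinearMap.le_of_opNorm_le _ (hM s hs hst) _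
    · have e : T.toFun s x = T.toFun t (T.toFun |s - t| x) := by
        rw [← T.map_add_apply ht (abs_nonneg _), abs_of_nonneg (by linarith)]; congr 2; ring
      rw [e, ← map_sub]
      exact (ContinuousLinearMap.le_opNorm _ _).trans (by gcongr; exact hM t ht (by linarith))
  have h1 : Tendsto (fun s : ℝ => |s - t|) (𝓝[Set.Ici 0] t) (𝓝[≥] 0) := by
    refine tendsto_nhdsWithin_iff.2 ⟨?_, Eventually.of_forall fun s => Set.mem_Ici.2 (abs_nonneg _)⟩
    have : Continuous fun s : ℝ => |s - t| := by fun_prop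
    have h := this.tendsto t
    simp only [sub_self, abs_zero] at h
    exact h.mono_left nhdsWithin_le_nhds
  have h2 : Tendsto (fun s : ℝ => M * ‖T.toFun |s - t| x - x‖) (𝓝[Set.Ici 0] t) (𝓝 0) := by
    have h := (((T.tendsto_zero_right x).comp h1).sub_const x).norm.const_mul M
    simpa using h
  refine tendsto_iff_norm_sub_tendsto_zero.2 (squeeze_zero' (Eventually.of_forall fun _ =>
    norm_nonneg _) ?_ h2)
  have h3 : ∀ᶠ s in 𝓝[Set.Ici 0] t, s ≤ t + 1 :=
    nhdsWithin_le_nhds (Iic_mem_nhds (by linarith))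
  filter_upwards [h3, self_mem_nhdsWithin] with s hs hs0 using hbound s hs0 hs

/-- Strong continuity of a composition with a continuous family of vectors. -/
theorem continuousOn_apply_of_continuousOn [CompleteSpace X] {f : ℝ → X} {b : ℝ}
    (hf : ContinuousOn f (Set.Icc 0 b)) :
    ContinuousOn (fun t => T.toFun t (f t)) (Set.Icc 0 b) := by
  obtain ⟨M, hM0, hM⟩ := T.exists_norm_le b
  intro t ht
  have h1 : Tendsto (fun s => T.toFun s (f t)) (𝓝[Set.Icc 0 b] t) (𝓝 (T.toFun t (f t))) :=
    (T.continuousOn_apply (f t) t ht.1).mono_left (nhdsWithin_mono _ Set.Icc_subset_Ici_self)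
  have h2 : Tendsto (fun s => T.toFun s (f s - f t)) (𝓝[Set.Icc 0 b] t) (𝓝 0) := by
    refine squeeze_zero_norm' (a := fun s => M * ‖f s - f t‖) ?_ ?_
    · filter_upwards [self_mem_nhdsWithin] with s hs
      exact (ContinuousLinearMap.le_opNorm _ _).trans (by gcongr; exact hM s hs.1 hs.2)
    · simpa using ((hf t ht).sub_const (f t)).norm.const_mul M
  have h3 := h1.add h2
  simpa [ContinuousWithinAt] using h3

variable {T} {A : X →ₗ.[ℂ] X}

/-- Only the right derivative is recorded; it suffices for the constancy criterion and the
fundamental theorem of calculus applied below. -/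
theorem IsGeneratedBy.hasDerivWithinAt (hT : T.IsGeneratedBy A) {x y : X} (hxy : (x, y) ∈ A.graph)
    {t : ℝ} (ht : 0 ≤ t) :
    HasDerivWithinAt (fun s => T.toFun s x) (T.toFun t y) (Set.Ioi t) t := by
  have h := (hT x y).1 hxy
  rw [hasDerivWithinAt_iff_tendsto_slope' (by simp)]
  have h1 : Tendsto (fun s : ℝ => s - t) (𝓝[>] t) (𝓝[>] 0) := by
    refine tendsto_nhdsWithin_iff.2 ⟨?_, ?_⟩
    · have : Continuous fun s : ℝ => s - t := by fun_prop
      have h := this.tendsto t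
      simp only [sub_self] at h
      exact h.mono_left nhdsWithin_le_nhds
    · filter_upwards [self_mem_nhdsWithin] with s hs
      simpa using hs
  refine (((T.toFun t).continuous.tendsto y).comp (h.comp h1)).congr' ?_
  filter_upwards [self_mem_nhdsWithin] with s hs
  have hs : t < s := hs
  have e : T.toFun s x = T.toFun t (T.toFun (s - t) x) := by
    rw [← T.map_add_apply ht (by linarith)]; congr 2; ring
  simp only [Function.comp, slope, map_smul, map_sub, vsub_eq_sub, e, ← Complex.coe_smul]

theorem IsGeneratedBy.map_mem_graph (hT : T.IsGeneratedBy A) {x y : X} (hxy : (x, y) ∈ A.graph)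
    {t : ℝ} (ht : 0 ≤ t) : (T.toFun t x, T.toFun t y) ∈ A.graph := by
  rw [hT]
  refine (((T.toFun t).continuous.tendsto y).comp ((hT x y).1 hxy)).congr' ?_
  filter_upwards [self_mem_nhdsWithin] with s hs
  have hs : 0 < s := hs
  simp only [Function.comp, map_smul, map_sub]
  rw [← T.map_add_apply ht hs.le, ← T.map_add_apply hs.le ht, add_comm]

theorem IsGeneratedBy.map_mem_domain (hT : T.IsGeneratedBy A) {x : X} (hx : x ∈ A.domain)
    {t : ℝ} (ht : 0 ≤ t) : T.toFun t x ∈ A.domain := by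
  have h := hT.map_mem_graph (A.mem_graph ⟨x, hx⟩) ht
  exact LinearPMap.mem_domain_of_mem_graph h

theorem IsGeneratedBy.pval_map (hT : T.IsGeneratedBy A) {x : X} (hx : x ∈ A.domain)
    {t : ℝ} (ht : 0 ≤ t) : pval A (T.toFun t x) = T.toFun t (pval A x) := by
  have h := hT.map_mem_graph (A.mem_graph ⟨x, hx⟩) ht
  rw [pval_of_mem A hx, pval_of_mem A (hT.map_mem_domain hx ht)]
  exact (LinearPMap.mem_graph_iff' A |>.1 h).elim fun z hz => by
    simp only [Prod.mk.injEq] at hz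
    rw [← hz.2]; congr 1; exact Subtype.ext hz.1.symm

/-! ### Density of the domain of a generator -/

section Density

open MeasureTheory intervalIntegral

theorem intervalIntegrable_apply [CompleteSpace X] (T : C0Semigroup X) (x : X) {a b : ℝ}
    (ha : 0 ≤ a) (hb : 0 ≤ b) :
    IntervalIntegrable (fun s => T.toFun s x) volume a b :=
  ((T.continuousOn_apply x).mono fun _ hs => (le_min ha hb).trans hs.1).intervalIntegrable

theorem tendsto_average [CompleteSpace X] (T : C0Semigroup X) (x : X) {h : ℝ} (hh : 0 ≤ h) :
    Tendsto (fun t : ℝ => ((t⁻¹ : ℝ) : ℂ) • ∫ s in h..(h + t), T.toFun s x) (𝓝[>] 0)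
      (𝓝 (T.toFun h x)) := by
  have hd : HasDerivWithinAt (fun u => ∫ s in h..u, T.toFun s x) (T.toFun h x) (Set.Ici h) h := by
    refine integral_hasDerivWithinAt_right (t := Set.Ioi h) (by simp) ?_ ?_
    · refine ⟨Set.Ioi h, self_mem_nhdsWithin, ?_⟩
      exact ((T.continuousOn_apply x).mono fun s hs => hh.trans (le_of_lt hs)).aestronglyMeasurable
        measurableSet_Ioi
    · exact (T.continuousOn_apply x h hh).mono fun s hs => hh.trans (le_of_lt hs)
  rw [hasDerivWithinAt_iff_tendsto_slope] at hd
  have h1 : Tendsto (fun t : ℝ => h + t) (𝓝[>] 0) (𝓝[Set.Ici h \ {h}] h) := by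
    refine tendsto_nhdsWithin_iff.2 ⟨?_, ?_⟩
    · have : Continuous fun s : ℝ => h + s := by fun_prop
      have h := this.tendsto 0
      simp only [add_zero] at h
      exact h.mono_left nhdsWithin_le_nhds
    · filter_upwards [self_mem_nhdsWithin] with s hs
      have hs : 0 < s := hs
      simpa using hs
  refine (hd.comp h1).congr fun t => ?_
  simp [slope, ← Complex.coe_smul]

/-- `T(t) - 1` applied to `∫₀ʰ T(s)x ds` telescopes to `∫ₕ^{h+t} - ∫₀ᵗ`, and after division by `t`
these averages tend to `T(h)x - x`. -/
theorem IsGeneratedBy.integral_mem_domain [CompleteSpace X] (hT : T.IsGeneratedBy A) (x : X)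
    {h : ℝ} (hh : 0 ≤ h) : (∫ s in (0 : ℝ)..h, T.toFun s x) ∈ A.domain := by
  refine LinearPMap.mem_domain_of_mem_graph (y := T.toFun h x - x) ?_
  rw [hT]
  have h0 := T.tendsto_average x le_rfl
  rw [T.map_zero_apply] at h0
  refine ((T.tendsto_average x hh).sub h0).congr' ?_
  filter_upwards [self_mem_nhdsWithin] with t ht
  have ht : 0 < t := ht
  rw [← smul_sub]
  congr 1
  have e1 : T.toFun t (∫ s in (0 : ℝ)..h, T.toFun s x) = ∫ s in t..(h + t), T.toFun s x := by
    rw [← ContinuousLinearMap.intervalIntegral_comp_comm _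
      (T.intervalIntegrable_apply x le_rfl hh)]
    have : (∫ s in (0 : ℝ)..h, T.toFun (s + t) x) = ∫ s in (0 + t)..(h + t), T.toFun s x :=
      integral_comp_add_right (fun s => T.toFun s x) t
    rw [zero_add] at this
    rw [← this]
    refine integral_congr fun s hs => ?_
    rw [Set.uIcc_of_le hh] at hs
    change T.toFun t (T.toFun s x) = T.toFun (s + t) x
    rw [add_comm, T.map_add_apply ht.le hs.1]
  have i := fun (a b : ℝ) (ha : 0 ≤ a) (hb : 0 ≤ b) =>
    T.intervalIntegrable_apply x (a := a) (b := b) ha hb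
  rw [e1, zero_add]
  rw [← integral_add_adjacent_intervals (i 0 t le_rfl ht.le) (i t h ht.le hh),
    ← integral_add_adjacent_intervals (i t h ht.le hh) (i h (h + t) hh (by linarith))]
  abel

/-- The averages `t⁻¹ ∫₀ᵗ T(s)x ds` lie in the domain and converge to `x`. -/
theorem IsGeneratedBy.dense_domain [CompleteSpace X] (hT : T.IsGeneratedBy A) :
    Dense (A.domain : Set X) := by
  intro x
  have h0 := T.tendsto_average x le_rfl
  rw [T.map_zero_apply] at h0
  refine mem_closure_of_tendsto h0 ?_
  filter_upwards [self_mem_nhdsWithin] with t ht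
  have ht : 0 < t := ht
  rw [zero_add]
  exact A.domain.smul_mem _ (hT.integral_mem_domain x ht.le)

end Density

/-! ### Eigenvectors and strong stability -/

theorem IsGeneratedBy.apply_eigenvector [CompleteSpace X] (hT : T.IsGeneratedBy A) {x : X}
    {mu : ℂ} (hx : (x, mu • x) ∈ A.graph) {t : ℝ} (ht : 0 ≤ t) :
    T.toFun t x = Complex.exp (mu * t) • x := by
  have hexp : ∀ s : ℝ, HasDerivAt (fun s : ℝ => Complex.exp (-(mu * s)))
      (Complex.exp (-(mu * s)) * -mu) s := by
    intro s
    have h1 : HasDerivAt (fun s : ℝ => (-(mu * s))) (-mu) s := by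
      have h2 : HasDerivAt (fun s : ℝ => (s : ℂ)) 1 s := Complex.ofRealCLM.hasDerivAt (x := s)
      simpa using (h2.const_mul mu).fun_neg
    exact h1.cexp
  have key := constant_of_has_deriv_right_zero (a := 0) (b := t)
    (f := fun s : ℝ => Complex.exp (-(mu * s)) • T.toFun s x)
    (by
      refine ContinuousOn.smul ?_ ((T.continuousOn_apply x).mono Set.Icc_subset_Ici_self)
      exact fun s _ => (hexp s).continuousAt.continuousWithinAt)
    (fun s hs => by
      have h1 := (hexp s).hasDerivWithinAt (s := Set.Ioi s)
      have h2 := h1.fun_smul (hT.hasDerivWithinAt hx hs.1)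
      rw [hasDerivWithinAt_Ioi_iff_Ici] at h2
      convert h2 using 1
      rw [map_smul, smul_smul, ← add_smul]
      simp)
  have h := key t ⟨ht, le_rfl⟩
  simp only [Complex.ofReal_zero, mul_zero, neg_zero, Complex.exp_zero, one_smul,
    T.map_zero_apply] at h
  conv_rhs => rw [← h, smul_smul, ← Complex.exp_add]
  simp

/-- The orbit of an eigenvector with imaginary eigenvalue has constant norm, so it can decay only if
the vector is zero. -/
theorem StronglyStable.eigenvector_eq_zero [CompleteSpace X] (hS : T.StronglyStable)
    (hT : T.IsGeneratedBy A) {x : X} {w : ℝ} (hx : (x, (Complex.I * (w : ℂ)) • x) ∈ A.graph) :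
    x = 0 := by
  have h1 := (hS x).norm
  have h2 : Tendsto (fun t : ℝ => ‖T.toFun t x‖) atTop (𝓝 ‖x‖) := by
    refine tendsto_const_nhds.congr' ?_
    filter_upwards [eventually_ge_atTop 0] with t ht
    rw [hT.apply_eigenvector hx ht, norm_smul, Complex.norm_exp]
    simp
  simpa using tendsto_nhds_unique h2 h1

end C0Semigroup

/-! ### Resolvents and the extrapolation space -/

section Resolvent

variable {X : Type*} [NormedAddCommGroup X] [NormedSpace ℂ X] {A : X →ₗ.[ℂ] X} {lam mu : ℂ}

theorem isResolventAt_resolvent (h : lam ∈ resolventSet A) :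
    IsResolventAt A lam (resolvent A lam) := by
  have h' : ∃ R : X →L[ℂ] X, IsResolventAt A lam R := h
  simp only [resolvent, dif_pos h']
  exact h'.choose_spec

theorem resolvent_mem_domain (h : lam ∈ resolventSet A) (x : X) :
    resolvent A lam x ∈ A.domain :=
  ((isResolventAt_resolvent h).1 x).1

theorem pval_resolvent (h : lam ∈ resolventSet A) (x : X) :
    pval A (resolvent A lam x) = lam • resolvent A lam x - x := by
  obtain ⟨h1, h2⟩ := (isResolventAt_resolvent h).1 x
  rw [pval_of_mem A h1]
  nth_rewrite 3 [← h2]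
  abel

theorem resolvent_apply_sub (h : lam ∈ resolventSet A) {x : X} (hx : x ∈ A.domain) :
    resolvent A lam (lam • x - pval A x) = x := by
  rw [pval_of_mem A hx]
  exact (isResolventAt_resolvent h).2 ⟨x, hx⟩

theorem resolvent_injective (h : lam ∈ resolventSet A) : Function.Injective (resolvent A lam) := by
  refine (injective_iff_map_eq_zero _).2 fun x hx => ?_
  have := pval_resolvent h x
  rw [hx] at this
  have h0 : pval A (0 : X) = 0 := by
    rw [pval_of_mem A A.domain.zero_mem]; exact A.map_zero
  rw [h0] at this
  simpa using this.symm

theorem resolvent_identity (hl : lam ∈ resolventSet A) (hm : mu ∈ resolventSet A) (x : X) :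
    resolvent A mu x = resolvent A lam x + (lam - mu) • resolvent A lam (resolvent A mu x) := by
  have h := resolvent_apply_sub hl (resolvent_mem_domain hm x)
  rw [pval_resolvent hm] at h
  conv_lhs => rw [← h]
  rw [← (resolvent A lam).map_smul, ← (resolvent A lam).map_add]
  congr 1
  module

theorem norm_embed (A : X →ₗ.[ℂ] X) (lam : ℂ) (x : X) :
    ‖embed A lam x‖ = ‖resolvent A lam x‖ := by
  have h : ‖((toPre A lam x : PreExtrapolation A lam) : Extrapolation A lam)‖
      = ‖toPre A lam x‖ := UniformSpace.Completion.norm_coe _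
  rw [← norm_toPre, ← h]
  rfl

theorem embed_injective (h : lam ∈ resolventSet A) : Function.Injective (embed A lam) := by
  refine (injective_iff_map_eq_zero _).2 fun x hx => ?_
  have := norm_embed A lam x
  rw [hx, norm_zero] at this
  exact resolvent_injective h (by rw [map_zero]; exact norm_eq_zero.1 this.symm)

theorem denseRange_embed (A : X →ₗ.[ℂ] X) (lam : ℂ) : DenseRange (embed A lam) :=
  (UniformSpace.Completion.denseRange_coe (α := PreExtrapolation A lam)).comp
    (toPre A lam).surjective.denseRange (UniformSpace.Completion.continuous_coe _)

/-- The extension by continuity takes the intended values only for a densely defined, bounded map.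
Here `A` is bounded from the norm of `X` to that of `X₋₁` because `R(lam, A) A y = lam R(lam, A) y -
y`. -/
theorem extendedGenerator_apply (hA : Dense (A.domain : Set X)) (h : lam ∈ resolventSet A)
    {x : X} (hx : x ∈ A.domain) :
    extendedGenerator A lam x = embed A lam (pval A x) := by
  rw [pval_of_mem A hx]
  refine LinearMap.extendOfNorm_eq (f := (embed A lam).toLinearMap.comp A.toFun)
    (e := A.domain.subtype) ?_ ⟨‖lam‖ * ‖resolvent A lam‖ + 1, ?_⟩ ⟨x, hx⟩
  · rw [DenseRange]
    simpa using hA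
  · intro y
    change ‖embed A lam (A y)‖ ≤ _ * ‖(y : X)‖
    rw [norm_embed]
    have h1 := resolvent_apply_sub h y.2
    rw [pval_of_mem A y.2, map_sub, map_smul] at h1
    have h2 : resolvent A lam (A y) = lam • resolvent A lam (y : X) - y := by
      rw [eq_sub_iff_add_eq, ← eq_sub_iff_add_eq']; exact h1.symm
    rw [h2]
    refine (norm_sub_le _ _).trans ?_
    rw [norm_smul, add_mul, one_mul, mul_assoc]
    gcongr
    exact (resolvent A lam).le_opNorm _

/-- On `Dom(A)` the norm on the left is `‖R(lam, A)(lam - A) y‖ = ‖y‖`; density does the rest. -/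
theorem norm_sub_extendedGenerator (hA : Dense (A.domain : Set X)) (h : lam ∈ resolventSet A)
    (x : X) : ‖(lam • embed A lam - extendedGenerator A lam) x‖ = ‖x‖ := by
  have hcl : IsClosed {x : X | ‖(lam • embed A lam - extendedGenerator A lam) x‖ = ‖x‖} :=
    isClosed_eq (lam • embed A lam - extendedGenerator A lam).continuous.norm continuous_norm
  refine hA.induction (P := fun x =>
    ‖(lam • embed A lam - extendedGenerator A lam) x‖ = ‖x‖) (fun y hy => ?_) hcl x
  have : (lam • embed A lam - extendedGenerator A lam) y = embed A lam (lam • y - pval A y) := by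
    simp [extendedGenerator_apply hA h hy]
  rw [this, norm_embed, resolvent_apply_sub h hy]

theorem sub_extendedGenerator_resolvent (hA : Dense (A.domain : Set X))
    (h : lam ∈ resolventSet A) (hm : mu ∈ resolventSet A) (x : X) :
    (mu • embed A lam - extendedGenerator A lam) (resolvent A mu x) = embed A lam x := by
  simp [extendedGenerator_apply hA h (resolvent_mem_domain hm x), pval_resolvent hm]

/-- An isometry on a complete space has closed range, and this range contains the dense copy of `X`.
-/
theorem isInvertible_sub_extendedGenerator_self [CompleteSpace X] (hA : Dense (A.domain : Set X))
    (h : lam ∈ resolventSet A) :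
    (lam • embed A lam - extendedGenerator A lam).IsInvertible := by
  set J := lam • embed A lam - extendedGenerator A lam with hJ
  have hiso : Isometry J := AddMonoidHomClass.isometry_of_norm J (norm_sub_extendedGenerator hA h)
  have hsurj : Function.Surjective J := by
    have hcl : IsClosed (Set.range J) := hiso.isClosedEmbedding.isClosed_range
    have hd : Dense (Set.range J) := (denseRange_embed A lam).mono (by
      rintro _ ⟨x, rfl⟩
      exact ⟨resolvent A lam x, sub_extendedGenerator_resolvent hA h h x⟩)
    intro y
    have : Set.range J = Set.univ := by rw [← hcl.closure_eq, hd.closure_eq]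
    exact Set.eq_univ_iff_forall.1 this y
  exact ⟨ContinuousLinearEquiv.ofBijective J (LinearMap.ker_eq_bot.2 hiso.injective)
    (LinearMap.range_eq_top.2 hsurj), rfl⟩

/-- Factor `mu - A₋₁ = (lam - A₋₁)(1 + (mu - lam) R(lam, A))`. By the resolvent identity the second
factor has the inverse `1 + (lam - mu) R(mu, A)`. Invertibility ensures that `extendedResolvent` is
a true inverse and not the default value. -/
theorem isInvertible_sub_extendedGenerator [CompleteSpace X] (hA : Dense (A.domain : Set X))
    (h : lam ∈ resolventSet A) (hm : mu ∈ resolventSet A) :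
    (mu • embed A lam - extendedGenerator A lam).IsInvertible := by
  have h1 : (ContinuousLinearMap.id ℂ X + (mu - lam) • resolvent A lam).IsInvertible := by
    refine ContinuousLinearMap.IsInvertible.of_inverse
      (g := ContinuousLinearMap.id ℂ X + (lam - mu) • resolvent A mu) ?_ ?_
    · ext x
      have e := resolvent_identity h hm x
      have : (mu - lam) • (resolvent A mu x) = (mu - lam) • (resolvent A lam x
        + (lam - mu) • resolvent A lam (resolvent A mu x)) := by rw [← e]
      simp only [ContinuousLinearMap.comp_apply, add_apply,
        ContinuousLinearMap.id_apply, smul_apply, map_add, map_smul]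
      linear_combination (norm := module) -this
    · ext x
      have e := resolvent_identity hm h x
      have : (mu - lam) • (resolvent A lam x) = (mu - lam) • (resolvent A mu x
        + (mu - lam) • resolvent A mu (resolvent A lam x)) := by rw [← e]
      simp only [ContinuousLinearMap.comp_apply, add_apply,
        ContinuousLinearMap.id_apply, smul_apply, map_add, map_smul]
      linear_combination (norm := module) this
  have e : mu • embed A lam - extendedGenerator A lam =
      (lam • embed A lam - extendedGenerator A lam) ∘L
        (ContinuousLinearMap.id ℂ X + (mu - lam) • resolvent A lam) := by
    ext x
    have := sub_extendedGenerator_resolvent hA h h x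
    rw [ContinuousLinearMap.comp_apply, add_apply, map_add,
      smul_apply, map_smul, this]
    simp only [sub_apply, smul_apply,
      ContinuousLinearMap.id_apply]
    module
  rw [e]
  exact (isInvertible_sub_extendedGenerator_self hA h).comp h1

theorem extendedResolvent_eq_iff [CompleteSpace X] (hA : Dense (A.domain : Set X))
    (h : lam ∈ resolventSet A) (hm : mu ∈ resolventSet A) {y : Extrapolation A lam} {x : X} :
    extendedResolvent A lam mu y = x ↔ y = mu • embed A lam x - extendedGenerator A lam x := by
  have := (isInvertible_sub_extendedGenerator hA h hm).inverse_apply_eq (x := x) (y := y)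
  simpa [extendedResolvent] using this

theorem extendedResolvent_embed [CompleteSpace X] (hA : Dense (A.domain : Set X))
    (h : lam ∈ resolventSet A) (hm : mu ∈ resolventSet A) (x : X) :
    extendedResolvent A lam mu (embed A lam x) = resolvent A mu x := by
  rw [extendedResolvent_eq_iff hA h hm, ← sub_extendedGenerator_resolvent hA h hm x]
  simp

/-- By the resolvent identity the difference is `(nu - mu) R(nu, A)` applied to a vector of `X`.
This carries the condition `ran(R(mu, A₋₁)B) ⊂ Dom(C)` from one point of the resolvent set to all
others. -/
theorem extendedResolvent_sub_mem_domain [CompleteSpace X] {nu : ℂ}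
    (hA : Dense (A.domain : Set X))
    (h : lam ∈ resolventSet A) (hm : mu ∈ resolventSet A) (hn : nu ∈ resolventSet A)
    (y : Extrapolation A lam) :
    extendedResolvent A lam mu y - extendedResolvent A lam nu y ∈ A.domain := by
  set x := extendedResolvent A lam mu y with hx
  have hy := (extendedResolvent_eq_iff hA h hm).1 hx.symm
  have e : extendedResolvent A lam nu y = x + (mu - nu) • resolvent A nu x := by
    rw [extendedResolvent_eq_iff hA h hn]
    have := sub_extendedGenerator_resolvent hA h hn x
    simp only [sub_apply, smul_apply] at this
    rw [hy, map_add, map_add, map_smul, map_smul]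
    linear_combination (norm := module) (nu - mu) • this
  rw [e, sub_add_cancel_left]
  exact A.domain.neg_mem (A.domain.smul_mem _ (resolvent_mem_domain hn x))

theorem extendedResolventPow_zero (A : X →ₗ.[ℂ] X) (lam mu : ℂ) (y : Extrapolation A lam) :
    extendedResolventPow A lam mu 0 y = extendedResolvent A lam mu y := rfl

theorem extendedResolventPow_succ [CompleteSpace X] (hA : Dense (A.domain : Set X))
    (h : lam ∈ resolventSet A) (hm : mu ∈ resolventSet A) (m : ℕ) (y : Extrapolation A lam) :
    extendedResolventPow A lam mu (m + 1) y =
      resolvent A mu (extendedResolventPow A lam mu m y) := by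
  rw [← extendedResolvent_embed hA h hm]
  simp only [extendedResolventPow, pow_succ', ContinuousLinearMap.comp_apply]
  rfl

end Resolvent

/-! ### The exosystem -/

namespace Exosystem

variable {I W : Type*} [NormedAddCommGroup W] [InnerProductSpace ℂ W] (S : Exosystem I W)

theorem inner_φ_self (k : I) (l m : Fin (S.n k)) :
    inner ℂ (S.φ k l) (S.φ k m) = if l = m then (1 : ℂ) else 0 := by
  classical
  have := orthonormal_iff_ite.1 S.basis.orthonormal ⟨k, l⟩ ⟨k, m⟩
  simpa [φ] using this

theorem norm_φ (k : I) (l : Fin (S.n k)) : ‖S.φ k l‖ = 1 := S.basis.orthonormal.1 _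

theorem proj_apply (k : I) (v : W) :
    S.proj k v = ∑ l : Fin (S.n k), inner ℂ (S.φ k l) v • S.φ k l := by
  simp [proj]

theorem continuous_proj (k : I) : Continuous (S.proj k) := by
  have : (S.proj k : W → W) = fun v => ∑ l : Fin (S.n k), inner ℂ (S.φ k l) v • S.φ k l :=
    funext fun v => S.proj_apply k v
  rw [this]
  fun_prop

theorem proj_φ_self (k : I) (l : Fin (S.n k)) : S.proj k (S.φ k l) = S.φ k l := by
  simp [proj_apply, inner_φ_self]

theorem proj_φ_of_ne {j k : I} (h : j ≠ k) (l : Fin (S.n k)) : S.proj j (S.φ k l) = 0 := by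
  simp [proj_apply, S.inner_φ_of_ne h]

theorem proj_proj_self (k : I) (v : W) : S.proj k (S.proj k v) = S.proj k v := by
  rw [proj_apply S k v, map_sum]
  simp only [map_smul, proj_φ_self]

theorem proj_proj_of_ne {j k : I} (h : j ≠ k) (v : W) : S.proj j (S.proj k v) = 0 := by
  rw [proj_apply S k v]
  simp [S.proj_φ_of_ne h]

theorem inner_proj_left (k : I) (v w : W) :
    inner ℂ (S.proj k v) w = inner ℂ v (S.proj k w) := by
  simp only [proj_apply, sum_inner, inner_sum, inner_smul_left, inner_smul_right]
  refine Finset.sum_congr rfl fun l _ => ?_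
  rw [inner_conj_symm]; ring

theorem inner_φ_proj (k : I) (l : Fin (S.n k)) (v : W) :
    inner ℂ (S.φ k l) (S.proj k v) = inner ℂ (S.φ k l) v := by
  rw [← inner_proj_left, proj_φ_self]

theorem norm_inner_φ_le (k : I) (l : Fin (S.n k)) (v : W) :
    ‖inner ℂ (S.φ k l) v‖ ≤ ‖S.proj k v‖ := by
  rw [← inner_φ_proj]
  simpa [S.norm_φ] using norm_inner_le_norm (𝕜 := ℂ) (S.φ k l) (S.proj k v)

theorem hasSum_proj (v : W) : HasSum (fun k => S.proj k v) v := by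
  have h := (S.basis.hasSum_repr v).sigma (g := fun k => S.proj k v) (fun k => by
    rw [proj_apply]
    convert hasSum_fintype _ using 2 with l
    rw [S.basis.repr_apply_apply]; rfl)
  exact h

theorem hasSum_norm_sq_proj (v : W) : HasSum (fun k => ‖S.proj k v‖ ^ 2) (‖v‖ ^ 2) := by
  have h := (S.hasSum_proj v).mapL (innerSL ℂ v)
  have h2 := h.mapL Complex.reCLM
  convert h2 using 1
  · ext k
    simp only [innerSL_apply_apply, Complex.reCLM_apply]
    rw [← S.proj_proj_self, ← inner_proj_left, S.proj_proj_self]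
    exact (inner_self_eq_norm_sq (𝕜 := ℂ) _).symm
  · exact (inner_self_eq_norm_sq (𝕜 := ℂ) _).symm

theorem orthogonalFamily_proj :
    OrthogonalFamily ℂ (fun k => LinearMap.range (S.proj k))
      (fun k => (LinearMap.range (S.proj k)).subtypeₗᵢ) := by
  rintro k j h ⟨_, v, rfl⟩ ⟨_, w, rfl⟩
  change inner ℂ (S.proj k v) (S.proj j w) = 0
  rw [inner_proj_left, S.proj_proj_of_ne h, inner_zero_right]

theorem summable_of_norm_sq [CompleteSpace W] {f : I → W} (hf : ∀ k, S.proj k (f k) = f k)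
    (hs : Summable fun k => ‖f k‖ ^ 2) : Summable f :=
  (S.orthogonalFamily_proj.summable_iff_norm_sq_summable (fun k => ⟨f k, f k, hf k⟩)).2 hs

theorem proj_tsum {f : I → W} (hf : ∀ k, S.proj k (f k) = f k) (hs : Summable f) (j : I) :
    S.proj j (∑' k, f k) = f j := by
  rw [hs.map_tsum (S.proj j) (S.continuous_proj j), tsum_eq_single j, hf]
  intro k hk
  rw [← hf k, S.proj_proj_of_ne hk.symm]

/-! ### The scale of spaces `W_α` -/

theorem weight_nonneg (α : ℝ) (v : W) (k : I) :
    0 ≤ (1 + S.ω k ^ 2) ^ α * ‖S.proj k v‖ ^ 2 := by positivity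

theorem mem_scale_of_le {α β c : ℝ} {v w : W} (hv : v ∈ S.scale β)
    (h : ∀ k, (1 + S.ω k ^ 2) ^ α * ‖S.proj k w‖ ^ 2 ≤
      c ^ 2 * ((1 + S.ω k ^ 2) ^ β * ‖S.proj k v‖ ^ 2)) : w ∈ S.scale α :=
  Summable.of_nonneg_of_le (S.weight_nonneg α w) h (Summable.mul_left (c ^ 2) hv)

/-- Blockwise comparison of weighted squares is the common source of the estimates below for the
embeddings `W_β ⊂ W_α`, for `S` and for the group. -/
theorem scaleNorm_le_of_le {α β c : ℝ} (hc : 0 ≤ c) {v w : W} (hv : v ∈ S.scale β)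
    (h : ∀ k, (1 + S.ω k ^ 2) ^ α * ‖S.proj k w‖ ^ 2 ≤
      c ^ 2 * ((1 + S.ω k ^ 2) ^ β * ‖S.proj k v‖ ^ 2)) :
    S.scaleNorm α w ≤ c * S.scaleNorm β v := by
  have e : c * S.scaleNorm β v =
      Real.sqrt (∑' k, c ^ 2 * ((1 + S.ω k ^ 2) ^ β * ‖S.proj k v‖ ^ 2)) := by
    rw [tsum_mul_left, Real.sqrt_mul (sq_nonneg c), Real.sqrt_sq hc, scaleNorm]
  rw [e]
  exact Real.sqrt_le_sqrt (Summable.tsum_le_tsum h (S.mem_scale_of_le hv h)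
    (Summable.mul_left (c ^ 2) hv))

theorem scaleNorm_nonneg (α : ℝ) (v : W) : 0 ≤ S.scaleNorm α v := Real.sqrt_nonneg _

theorem norm_eq_scaleNorm_zero (v : W) : ‖v‖ = S.scaleNorm 0 v := by
  simp [scaleNorm, (S.hasSum_norm_sq_proj v).tsum_eq]

theorem weight_mono {α β : ℝ} (h : α ≤ β) (v : W) (k : I) :
    (1 + S.ω k ^ 2) ^ α * ‖S.proj k v‖ ^ 2 ≤
      1 ^ 2 * ((1 + S.ω k ^ 2) ^ β * ‖S.proj k v‖ ^ 2) := by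
  rw [one_pow, one_mul]
  gcongr
  nlinarith [sq_nonneg (S.ω k)]

theorem scale_mono {α β : ℝ} (h : α ≤ β) : S.scale β ≤ S.scale α := fun v hv =>
  S.mem_scale_of_le (c := 1) hv (S.weight_mono h v)

theorem scale_add_one_le (α : ℝ) : S.scale (α + 1) ≤ S.scale α :=
  S.scale_mono (by linarith)

theorem scaleNorm_mono {α β : ℝ} (h : α ≤ β) {v : W} (hv : v ∈ S.scale β) :
    S.scaleNorm α v ≤ S.scaleNorm β v := by
  simpa using S.scaleNorm_le_of_le (c := 1) zero_le_one hv (S.weight_mono h v)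

theorem norm_le_scaleNorm {β : ℝ} (h : 0 ≤ β) {v : W} (hv : v ∈ S.scale β) :
    ‖v‖ ≤ S.scaleNorm β v :=
  (S.norm_eq_scaleNorm_zero v).trans_le (S.scaleNorm_mono h hv)

theorem φ_mem_scale (β : ℝ) (k : I) (l : Fin (S.n k)) : S.φ k l ∈ S.scale β := by
  refine summable_of_ne_finset_zero (s := {k}) fun j hj => ?_
  rw [S.proj_φ_of_ne (by simpa using hj)]
  simp

/-- The projection onto finitely many blocks. -/
def trunc (s : Finset I) : W →ₗ[ℂ] W := ∑ k ∈ s, S.proj k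

theorem trunc_apply (s : Finset I) (v : W) : S.trunc s v = ∑ k ∈ s, S.proj k v := by
  simp [trunc]

theorem proj_sub_trunc [DecidableEq I] (s : Finset I) (v : W) (j : I) :
    S.proj j (v - S.trunc s v) = if j ∈ s then 0 else S.proj j v := by
  have h : ∀ k, S.proj j (S.proj k v) = if j = k then S.proj k v else 0 := by
    intro k
    split_ifs with h
    · subst h; exact S.proj_proj_self _ _
    · exact S.proj_proj_of_ne h v
  rw [trunc_apply, map_sub, map_sum, Finset.sum_congr rfl fun k _ => h k, Finset.sum_ite_eq]
  split_ifs <;> simp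

/-- Membership of `v` in `W_β` is not needed: if the weighted squares are not summable, neither are
their tails, and the sums take the default value zero. -/
theorem tendsto_scaleNorm_sub_trunc (β : ℝ) (v : W) :
    Tendsto (fun s : Finset I => S.scaleNorm β (v - S.trunc s v)) atTop (𝓝 0) := by
  classical
  have h := tendsto_tsum_compl_atTop_zero
    (fun k => (1 + S.ω k ^ 2) ^ β * ‖S.proj k v‖ ^ 2)
  have h2 := (Real.continuous_sqrt.tendsto 0).comp h
  rw [Real.sqrt_zero] at h2
  refine h2.congr fun s => ?_
  simp only [Function.comp, scaleNorm]
  congr 1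
  rw [show (∑' a : { x // x ∉ s }, (1 + S.ω a ^ 2) ^ β * ‖S.proj a v‖ ^ 2) = _ from
    tsum_subtype {x | x ∉ s} (fun k => (1 + S.ω k ^ 2) ^ β * ‖S.proj k v‖ ^ 2)]
  refine tsum_congr fun k => ?_
  rw [proj_sub_trunc]
  by_cases hk : k ∈ s <;> simp [hk]

theorem trunc_mem_scale (β : ℝ) (s : Finset I) (v : W) : S.trunc s v ∈ S.scale β := by
  rw [trunc_apply]
  refine Submodule.sum_mem _ fun k _ => ?_
  rw [proj_apply]
  exact Submodule.sum_mem _ fun l _ => Submodule.smul_mem _ _ (S.φ_mem_scale β k l)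

/-- A bounded linear map on `W_β` vanishes if it vanishes at the basis vectors. -/
theorem eq_zero_of_forall_φ {V : Type*} [NormedAddCommGroup V] [NormedSpace ℂ V] {β M : ℝ}
    (f : S.scale β →ₗ[ℂ] V) (hf : ∀ v : S.scale β, ‖f v‖ ≤ M * S.scaleNorm β v)
    (h : ∀ k l, f ⟨S.φ k l, S.φ_mem_scale β k l⟩ = 0) (v : S.scale β) : f v = 0 := by
  have h1 : ∀ s : Finset I, f ⟨S.trunc s v, S.trunc_mem_scale β s v⟩ = 0 := by
    intro s
    have : (⟨S.trunc s v, S.trunc_mem_scale β s v⟩ : S.scale β) =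
        ∑ k ∈ s, ∑ l : Fin (S.n k),
          inner ℂ (S.φ k l) (v : W) • (⟨S.φ k l, S.φ_mem_scale β k l⟩ : S.scale β) := by
      apply Subtype.ext
      simp [trunc_apply, proj_apply]
    rw [this]
    simp only [map_sum, map_smul, h, smul_zero, Finset.sum_const_zero]
  -- Since `f` vanishes on truncations, `f v` is its value at a tail of `v`, and tails are small in
  -- `W_β`.
  have h2 : ∀ s : Finset I, ‖f v‖ ≤ M * S.scaleNorm β (v - S.trunc s v) := by
    intro s
    have := hf (v - ⟨S.trunc s v, S.trunc_mem_scale β s v⟩)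
    rwa [map_sub, h1, sub_zero] at this
  have h3 : Tendsto (fun s : Finset I => M * S.scaleNorm β (v - S.trunc s v)) atTop (𝓝 0) := by
    simpa using (S.tendsto_scaleNorm_sub_trunc β v).const_mul M
  exact norm_le_zero_iff.1 (ge_of_tendsto' h3 h2)

/-! ### The system operator -/

theorem blockVec_eq_proj (k : I) (l : Fin (S.n k)) : S.proj k (S.blockVec k l) = S.blockVec k l := by
  unfold blockVec
  split_ifs <;> simp [proj_φ_self]

theorem proj_block (k : I) (v : W) : S.proj k (S.block k v) = S.block k v := by
  simp [block_apply, blockVec_eq_proj]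

theorem norm_blockVec_le (k : I) (l : Fin (S.n k)) : ‖S.blockVec k l‖ ≤ |S.ω k| + 1 := by
  unfold blockVec
  refine (norm_add_le _ _).trans (add_le_add ?_ ?_)
  · simp [norm_smul, norm_φ, freq]
  · split_ifs <;> simp [norm_φ]

theorem norm_block_le (k : I) (v : W) :
    ‖S.block k v‖ ≤ S.n k * (|S.ω k| + 1) * ‖S.proj k v‖ := by
  rw [block_apply]
  refine (norm_sum_le _ _).trans ?_
  refine (Finset.sum_le_card_nsmul _ _ ((|S.ω k| + 1) * ‖S.proj k v‖) fun l _ => ?_).trans ?_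
  · rw [norm_smul, mul_comm]
    gcongr
    · exact S.norm_blockVec_le k l
    · exact S.norm_inner_φ_le k l v
  · simp [mul_assoc]

theorem scaleNorm_op_le [CompleteSpace W] {α : ℝ} :
    ∃ c : ℝ, ∀ v : S.op.domain, (v : W) ∈ S.scale (α + 1) →
      S.scaleNorm α (S.op v) ≤ c * S.scaleNorm (α + 1) v := by
  obtain ⟨N, hN⟩ := S.n_bounded
  -- `S` costs one power of the weight because `(|ω| + 1)² ≤ 4 (1 + ω²)`. The factor 2 is the root
  -- of this 4, and `N` bounds the number of vectors in a block.
  refine ⟨N * 2, fun v hv => S.scaleNorm_le_of_le (by positivity) hv fun k => ?_⟩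
  have h1 : S.proj k (S.op v) = S.block k v :=
    S.proj_tsum (fun k => S.proj_block k v) (S.summable_block v.2) k
  rw [h1, Real.rpow_add (by positivity), Real.rpow_one]
  have h2 := S.norm_block_le k v
  have h3 : (S.n k : ℝ) ≤ N := by exact_mod_cast hN k
  have h4 : ‖S.block k v‖ ^ 2 ≤ (N * (|S.ω k| + 1) * ‖S.proj k v‖) ^ 2 := by
    gcongr
    exact h2.trans (by gcongr)
  have h5 : (|S.ω k| + 1) ^ 2 ≤ 4 * (1 + S.ω k ^ 2) := by
    nlinarith [sq_abs (S.ω k), sq_nonneg (|S.ω k| - 1), abs_nonneg (S.ω k)]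
  calc _ ≤ (1 + S.ω k ^ 2) ^ α * (N * (|S.ω k| + 1) * ‖S.proj k v‖) ^ 2 := by gcongr
    _ = (1 + S.ω k ^ 2) ^ α * N ^ 2 * ‖S.proj k v‖ ^ 2 * (|S.ω k| + 1) ^ 2 := by ring
    _ ≤ (1 + S.ω k ^ 2) ^ α * N ^ 2 * ‖S.proj k v‖ ^ 2 * (4 * (1 + S.ω k ^ 2)) := by gcongr
    _ = _ := by ring

theorem op_φ [CompleteSpace W] (k : I) (l : Fin (S.n k)) (h : S.φ k l ∈ S.op.domain) :
    S.op ⟨S.φ k l, h⟩ = S.blockVec k l := by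
  change ∑' j, S.block j (S.φ k l) = _
  rw [tsum_eq_single k]
  · simp [block_apply, inner_φ_self]
  · intro j hj
    simp [block_apply, S.inner_φ_of_ne hj]

/-! ### The group generated by the system operator -/

/-- The value of the group at a basis vector. -/
def groupVec (k : I) (t : ℝ) (l : Fin (S.n k)) : W :=
  Complex.exp (S.freq k * t) •
    ∑ j ∈ Finset.Iic l, ((t : ℂ) ^ ((l : ℕ) - j) / (((l : ℕ) - j).factorial : ℂ)) • S.φ k j

/-- The restriction of the group to a block. -/
def blockGroup (k : I) (t : ℝ) : W →ₗ[ℂ] W :=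
  ∑ l : Fin (S.n k), (innerₛₗ ℂ (S.φ k l)).smulRight (S.groupVec k t l)

theorem blockGroup_apply (k : I) (t : ℝ) (v : W) :
    S.blockGroup k t v = ∑ l : Fin (S.n k), inner ℂ (S.φ k l) v • S.groupVec k t l := by
  simp [blockGroup]

theorem group_eq_tsum (t : ℝ) (v : W) : S.group t v = ∑' k, S.blockGroup k t v := by
  unfold group
  refine tsum_congr fun k => ?_
  simp only [blockGroup_apply, groupVec, Finset.smul_sum]
  refine Finset.sum_congr rfl fun l _ => Finset.sum_congr rfl fun j _ => ?_
  rw [smul_comm]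

theorem proj_groupVec (k : I) (t : ℝ) (l : Fin (S.n k)) :
    S.proj k (S.groupVec k t l) = S.groupVec k t l := by
  simp [groupVec, proj_φ_self]

theorem proj_blockGroup (k : I) (t : ℝ) (v : W) :
    S.proj k (S.blockGroup k t v) = S.blockGroup k t v := by
  simp [blockGroup_apply, proj_groupVec]

theorem norm_groupVec_le (k : I) (t : ℝ) (l : Fin (S.n k)) :
    ‖S.groupVec k t l‖ ≤ S.n k * Real.exp |t| := by
  rw [groupVec, norm_smul]
  have h1 : ‖Complex.exp (S.freq k * t)‖ = 1 := by
    rw [Complex.norm_exp]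
    simp [freq]
  rw [h1, one_mul]
  refine (norm_sum_le _ _).trans ?_
  refine (Finset.sum_le_card_nsmul _ _ (Real.exp |t|) fun j _ => ?_).trans ?_
  · rw [norm_smul, norm_φ, mul_one, norm_div, norm_pow, Complex.norm_real, Real.norm_eq_abs,
      Complex.norm_natCast]
    exact Real.pow_div_factorial_le_exp _ (abs_nonneg t) _
  · rw [nsmul_eq_mul]
    gcongr
    simp

/-- The bound is crude in `t` but involves `k` only through `n_k`. As the block sizes are bounded,
each `T_S(t)` is then bounded on every `W_β`. -/
theorem norm_blockGroup_le (k : I) (t : ℝ) (v : W) :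
    ‖S.blockGroup k t v‖ ≤ (S.n k : ℝ) ^ 2 * Real.exp |t| * ‖S.proj k v‖ := by
  rw [blockGroup_apply]
  refine (norm_sum_le _ _).trans ?_
  refine (Finset.sum_le_card_nsmul _ _ (S.n k * Real.exp |t| * ‖S.proj k v‖) fun l _ => ?_).trans ?_
  · rw [norm_smul, mul_comm]
    gcongr
    · exact S.norm_groupVec_le k t l
    · exact S.norm_inner_φ_le k l v
  · simp only [Finset.card_univ, Fintype.card_fin, nsmul_eq_mul]
    exact le_of_eq (by ring)

/-- A uniform bound for the block sizes. -/
def maxSize : ℕ := S.n_bounded.choose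

theorem norm_blockGroup_le_maxSize (k : I) (t : ℝ) (v : W) :
    ‖S.blockGroup k t v‖ ≤ (S.maxSize : ℝ) ^ 2 * Real.exp |t| * ‖S.proj k v‖ := by
  refine (S.norm_blockGroup_le k t v).trans ?_
  gcongr
  exact S.n_bounded.choose_spec k

theorem norm_sq_blockGroup_le (k : I) (t : ℝ) (v : W) :
    ‖S.blockGroup k t v‖ ^ 2 ≤
      ((S.maxSize : ℝ) ^ 2 * Real.exp |t|) ^ 2 * ‖S.proj k v‖ ^ 2 := by
  rw [← mul_pow]
  gcongr
  exact S.norm_blockGroup_le_maxSize k t v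

theorem mem_scale_zero (v : W) : v ∈ S.scale 0 := by
  have := (S.hasSum_norm_sq_proj v).summable
  change Summable fun k => (1 + S.ω k ^ 2) ^ (0 : ℝ) * ‖S.proj k v‖ ^ 2
  simpa using this

theorem group_φ (k : I) (t : ℝ) (l : Fin (S.n k)) : S.group t (S.φ k l) = S.groupVec k t l := by
  rw [group_eq_tsum, tsum_eq_single k]
  · simp [blockGroup_apply, inner_φ_self]
  · intro j hj
    simp [blockGroup_apply, S.inner_φ_of_ne hj]

theorem continuous_groupVec (k : I) (l : Fin (S.n k)) :
    Continuous fun t => S.groupVec k t l := by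
  unfold groupVec
  fun_prop

variable [CompleteSpace W]

theorem summable_blockGroup (t : ℝ) (v : W) : Summable fun k => S.blockGroup k t v :=
  S.summable_of_norm_sq (fun k => S.proj_blockGroup k t v) <|
    Summable.of_nonneg_of_le (fun _ => sq_nonneg _) (fun k => S.norm_sq_blockGroup_le k t v)
      ((S.hasSum_norm_sq_proj v).summable.mul_left _)

theorem group_add (t : ℝ) (v w : W) : S.group t (v + w) = S.group t v + S.group t w := by
  simp only [group_eq_tsum, map_add]
  exact (S.summable_blockGroup t v).tsum_add (S.summable_blockGroup t w)

theorem group_smul (t : ℝ) (c : ℂ) (v : W) : S.group t (c • v) = c • S.group t v := by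
  simp only [group_eq_tsum, map_smul]
  exact (S.summable_blockGroup t v).tsum_const_smul c

theorem proj_group (k : I) (t : ℝ) (v : W) : S.proj k (S.group t v) = S.blockGroup k t v := by
  rw [group_eq_tsum]
  exact S.proj_tsum (fun k => S.proj_blockGroup k t v) (S.summable_blockGroup t v) k

theorem weight_group_le (β t : ℝ) (v : W) (k : I) :
    (1 + S.ω k ^ 2) ^ β * ‖S.proj k (S.group t v)‖ ^ 2 ≤
      ((S.maxSize : ℝ) ^ 2 * Real.exp |t|) ^ 2 * ((1 + S.ω k ^ 2) ^ β * ‖S.proj k v‖ ^ 2) := by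
  rw [proj_group, mul_left_comm]
  gcongr
  exact S.norm_sq_blockGroup_le k t v

theorem group_mem_scale {β : ℝ} (t : ℝ) {v : W} (hv : v ∈ S.scale β) :
    S.group t v ∈ S.scale β :=
  S.mem_scale_of_le hv (S.weight_group_le β t v)

theorem scaleNorm_group_le {β : ℝ} (t : ℝ) {v : W} (hv : v ∈ S.scale β) :
    S.scaleNorm β (S.group t v) ≤
      ((S.maxSize : ℝ) ^ 2 * Real.exp |t|) * S.scaleNorm β v :=
  S.scaleNorm_le_of_le (by positivity) hv (S.weight_group_le β t v)

theorem norm_group_le (t : ℝ) (v : W) :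
    ‖S.group t v‖ ≤ ((S.maxSize : ℝ) ^ 2 * Real.exp |t|) * ‖v‖ := by
  rw [S.norm_eq_scaleNorm_zero, S.norm_eq_scaleNorm_zero v]
  exact S.scaleNorm_group_le t (S.mem_scale_zero v)

/-- The operators of the group as linear maps. -/
def groupₗ (t : ℝ) : W →ₗ[ℂ] W where
  toFun := S.group t
  map_add' := S.group_add t
  map_smul' := S.group_smul t

theorem group_sub (t : ℝ) (v w : W) : S.group t (v - w) = S.group t v - S.group t w :=
  map_sub (S.groupₗ t) v w

theorem group_trunc (s : Finset I) (t : ℝ) (v : W) :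
    S.group t (S.trunc s v) =
      ∑ k ∈ s, ∑ l : Fin (S.n k), inner ℂ (S.φ k l) v • S.groupVec k t l := by
  change S.groupₗ t _ = _
  rw [trunc_apply, map_sum]
  refine Finset.sum_congr rfl fun k _ => ?_
  rw [proj_apply, map_sum]
  refine Finset.sum_congr rfl fun l _ => ?_
  rw [map_smul, ← group_φ]
  rfl

/-- On `[0, b]` the orbit is a uniform limit of the orbits of truncations, which are finite sums of
explicit continuous functions. -/
theorem continuousOn_group (v : W) (b : ℝ) :
    ContinuousOn (fun t => S.group t v) (Set.Icc 0 b) := by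
  refine continuousOn_of_uniform_approx_of_continuousOn fun u hu => ?_
  obtain ⟨ε, hε, hu⟩ := Metric.mem_uniformity_dist.1 hu
  have h := (S.tendsto_scaleNorm_sub_trunc 0 v).const_mul
    ((S.maxSize : ℝ) ^ 2 * Real.exp b)
  rw [mul_zero] at h
  obtain ⟨s, hs⟩ := (h.eventually_lt_const hε).exists
  refine ⟨fun t => S.group t (S.trunc s v), ?_, fun t ht => hu ?_⟩
  · simp only [group_trunc]
    have := S.continuous_groupVec
    fun_prop
  · rw [dist_eq_norm, ← group_sub]
    refine (S.norm_group_le _ _).trans_lt (lt_of_le_of_lt ?_ hs)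
    rw [S.norm_eq_scaleNorm_zero, abs_of_nonneg ht.1]
    have := S.scaleNorm_nonneg 0 (v - S.trunc s v)
    gcongr
    exact ht.2

end Exosystem

/-! ### The mild solution of the closed-loop system -/

/-- The scalar function `e^{mu t} t^m / m!`. -/
def expMonomial (mu : ℂ) (m : ℕ) (t : ℝ) : ℂ :=
  Complex.exp (mu * t) * ((t : ℂ) ^ m / (m.factorial : ℂ))

theorem continuous_expMonomial (mu : ℂ) (m : ℕ) : Continuous (expMonomial mu m) := by
  unfold expMonomial
  fun_prop

theorem expMonomial_zero_zero (mu : ℂ) : expMonomial mu 0 0 = 1 := by simp [expMonomial]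

theorem expMonomial_succ_zero (mu : ℂ) (m : ℕ) : expMonomial mu (m + 1) 0 = 0 := by
  simp [expMonomial]

theorem norm_expMonomial_zero {mu : ℂ} (hmu : mu.re = 0) (t : ℝ) : ‖expMonomial mu 0 t‖ = 1 := by
  simp [expMonomial, Complex.norm_exp, hmu]

/-- The functions `e^{mu t} t^m / m!` form a Jordan chain of `d/dt` at `mu`, matching the chains of
`S`. -/
theorem hasDerivAt_expMonomial (mu : ℂ) (m : ℕ) (t : ℝ) :
    HasDerivAt (expMonomial mu m)
      (mu * expMonomial mu m t + if 0 < m then expMonomial mu (m - 1) t else 0) t := by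
  have h0 : HasDerivAt (fun s : ℝ => (s : ℂ)) 1 t := Complex.ofRealCLM.hasDerivAt (x := t)
  have h1 := (h0.const_mul mu).cexp
  have h2 := (h0.fun_pow m).div_const (m.factorial : ℂ)
  have h3 := h1.fun_mul h2
  refine h3.congr_deriv ?_
  rcases m with _ | m
  · simp [expMonomial, mul_comm]
  · have : ((m.factorial : ℕ) : ℂ) ≠ 0 := by exact_mod_cast m.factorial_ne_zero
    have : ((m : ℂ) + 1) ≠ 0 := by exact_mod_cast m.succ_ne_zero
    simp only [expMonomial, Nat.factorial_succ, Nat.cast_mul, Nat.cast_add, Nat.cast_one,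
      add_tsub_cancel_right, mul_one, Nat.succ_pos, if_true]
    field_simp

/-- The index shift behind `integral_chain`: lowering the degree of the scalar factors has the same
effect as lowering the index of the chain, so the two contributions cancel in the derivative. -/
theorem sum_expMonomial_shift {V : Type*} [AddCommGroup V] [Module ℂ V] (c : ℕ → ℂ) (y : ℕ → V)
    (l : ℕ) :
    ∑ j ∈ Finset.range (l + 1), (if 0 < l - j then c (l - j - 1) else 0) • y j =
      ∑ j ∈ Finset.range (l + 1), c (l - j) • (if 0 < j then y (j - 1) else 0) := by
  rw [Finset.sum_range_succ, Finset.sum_range_succ']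
  simp only [tsub_self, lt_self_iff_false, if_false, zero_smul, smul_zero, add_zero,
    Nat.succ_pos, if_true, add_tsub_cancel_right]
  refine Finset.sum_congr rfl fun j hj => ?_
  have hj := Finset.mem_range.1 hj
  rw [if_pos (by omega)]
  congr 2

section Mild

open MeasureTheory intervalIntegral

variable {V : Type*} [NormedAddCommGroup V] [NormedSpace ℂ V] [CompleteSpace V]
  {T : C0Semigroup V} {A : V →ₗ.[ℂ] V}

/-- Variation of constants for a Jordan chain. -/
theorem C0Semigroup.IsGeneratedBy.integral_chain (hT : T.IsGeneratedBy A) (mu : ℂ) (h b : ℕ → V)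
    (l : ℕ) (hh : ∀ j ≤ l, (h j, mu • h j + (if 0 < j then h (j - 1) else 0) - b j) ∈ A.graph)
    {t : ℝ} (ht : 0 ≤ t) :
    ∫ s in (0 : ℝ)..t, T.toFun s (∑ j ∈ Finset.range (l + 1), expMonomial mu (l - j) (t - s) • b j)
      = ∑ j ∈ Finset.range (l + 1), expMonomial mu (l - j) t • h j - T.toFun t (h l) := by
  -- When `h` is the image under `Σ` of the basis vectors of a block, `g s` is `T(s) Σ T_S(t - s)
  -- φ`. The chain relation makes its right derivative equal to `-f s`, so integrating over `[0, t]`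
  -- gives the formula.
  set g : ℝ → V := fun s =>
    ∑ j ∈ Finset.range (l + 1), expMonomial mu (l - j) (t - s) • T.toFun s (h j) with hg
  set f : ℝ → V := fun s =>
    T.toFun s (∑ j ∈ Finset.range (l + 1), expMonomial mu (l - j) (t - s) • b j) with hf
  have hcont : ∀ m, Continuous fun s : ℝ => expMonomial mu m (t - s) := fun m =>
    (continuous_expMonomial mu m).comp (by fun_prop)
  have hfc : ContinuousOn f (Set.Icc 0 t) := by
    refine T.continuousOn_apply_of_continuousOn (Continuous.continuousOn ?_)
    fun_prop
  have hgc : ContinuousOn g (Set.Icc 0 t) := by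
    refine continuousOn_finsetSum _ fun j _ => (hcont _).continuousOn.smul ?_
    exact (T.continuousOn_apply (h j)).mono Set.Icc_subset_Ici_self
  have hderiv : ∀ s ∈ Set.Ioo 0 t, HasDerivWithinAt g (-f s) (Set.Ioi s) s := by
    intro s hs
    have h1 : ∀ j ∈ Finset.range (l + 1), HasDerivWithinAt
        (fun s => expMonomial mu (l - j) (t - s) • T.toFun s (h j))
        (expMonomial mu (l - j) (t - s) •
            T.toFun s (mu • h j + (if 0 < j then h (j - 1) else 0) - b j) +
          (-(mu * expMonomial mu (l - j) (t - s) +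
            if 0 < l - j then expMonomial mu (l - j - 1) (t - s) else 0)) • T.toFun s (h j))
        (Set.Ioi s) s := by
      intro j hj
      have hj := Finset.mem_range.1 hj
      have e1 : HasDerivAt (fun s : ℝ => t - s) (-1) s := (hasDerivAt_id s).const_sub t
      have e2 := (hasDerivAt_expMonomial mu (l - j) (t - s)).scomp s e1
      have e3 := e2.hasDerivWithinAt (s := Set.Ioi s)
      have e4 := e3.fun_smul (hT.hasDerivWithinAt (hh j (by omega)) hs.1.le)
      simpa only [Function.comp, neg_smul, one_smul] using e4
    refine (HasDerivWithinAt.fun_sum h1).congr_deriv ?_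
    have hsh := sum_expMonomial_shift (fun m => expMonomial mu m (t - s))
      (fun j => T.toFun s (h j)) l
    have e : ∀ j, T.toFun s (if 0 < j then h (j - 1) else 0) =
        if 0 < j then T.toFun s (h (j - 1)) else 0 := by
      intro j; split_ifs <;> simp
    have key : ∀ j, expMonomial mu (l - j) (t - s) •
            T.toFun s (mu • h j + (if 0 < j then h (j - 1) else 0) - b j) +
          (-(mu * expMonomial mu (l - j) (t - s) +
            if 0 < l - j then expMonomial mu (l - j - 1) (t - s) else 0)) • T.toFun s (h j) =
        expMonomial mu (l - j) (t - s) • (if 0 < j then T.toFun s (h (j - 1)) else 0) -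
        (if 0 < l - j then expMonomial mu (l - j - 1) (t - s) else 0) • T.toFun s (h j) -
        expMonomial mu (l - j) (t - s) • T.toFun s (b j) := by
      intro j
      rw [(T.toFun s).map_sub, (T.toFun s).map_add, e, (T.toFun s).map_smul]
      module
    rw [Finset.sum_congr rfl fun j _ => key j, Finset.sum_sub_distrib, Finset.sum_sub_distrib,
      hsh, sub_self, zero_sub, hf]
    simp only [map_sum, map_smul]
  have hint : IntervalIntegrable (fun s => -f s) volume 0 t := by
    refine ContinuousOn.intervalIntegrable ?_
    rw [Set.uIcc_of_le ht]
    exact hfc.neg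
  have h := integral_eq_sub_of_hasDeriv_right_of_le ht hgc hderiv hint
  rw [intervalIntegral.integral_neg, neg_eq_iff_eq_neg] at h
  rw [h, neg_sub]
  congr 1
  · simp [hg, T.map_zero_apply]
  · simp only [hg, sub_self]
    -- At `s = t` every monomial of positive degree vanishes; only the term `j = l` remains.
    rw [Finset.sum_range_succ, Finset.sum_eq_zero]
    · simp [expMonomial_zero_zero]
    · intro j hj
      have hj := Finset.mem_range.1 hj
      obtain ⟨m, hm⟩ : ∃ m, l - j = m + 1 := ⟨l - j - 1, by omega⟩
      rw [hm, expMonomial_succ_zero, zero_smul]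

end Mild

/-! ### Jordan blocks with natural number indices -/

namespace Exosystem

variable {I W : Type*} [NormedAddCommGroup W] [InnerProductSpace ℂ W] (S : Exosystem I W)

/-- The basis vectors of a block, extended by zero. -/
def φExt (k : I) (j : ℕ) : W := if h : j < S.n k then S.φ k ⟨j, h⟩ else 0

theorem φExt_mem_scale (β : ℝ) (k : I) (j : ℕ) : S.φExt k j ∈ S.scale β := by
  unfold φExt
  split_ifs
  · exact S.φ_mem_scale β k _
  · exact Submodule.zero_mem _

theorem φExt_coe (k : I) (l : Fin (S.n k)) : S.φExt k l = S.φ k l := by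
  simp [φExt]

theorem blockVec_eq_φExt (k : I) (l : Fin (S.n k)) :
    S.blockVec k l = S.freq k • S.φExt k l + if 0 < (l : ℕ) then S.φExt k (l - 1) else 0 := by
  have : (l : ℕ) - 1 < S.n k := by omega
  simp [blockVec, φExt, this]

theorem groupVec_eq_sum (k : I) (t : ℝ) (l : Fin (S.n k)) :
    S.groupVec k t l =
      ∑ j ∈ Finset.range (l + 1), expMonomial (S.freq k) (l - j) t • S.φExt k j := by
  rw [groupVec, Finset.smul_sum]
  refine Finset.sum_bij (fun j _ => (j : ℕ)) ?_ ?_ ?_ ?_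
  · intro j hj
    have := Finset.mem_Iic.1 hj
    exact Finset.mem_range.2 (Nat.lt_succ_of_le this)
  · intro i _ j _ h
    exact Fin.ext h
  · intro j hj
    have := Finset.mem_range.1 hj
    exact ⟨⟨j, by omega⟩, Finset.mem_Iic.2 (Fin.mk_le_of_le_val (by omega)), rfl⟩
  · intro j _
    rw [φExt_coe, smul_smul, expMonomial]

theorem map_group_φ {V' : Type*} [AddCommGroup V'] [Module ℂ V'] {β : ℝ}
    (f : S.scale β →ₗ[ℂ] V') (k : I) (l : Fin (S.n k)) (t : ℝ) (h : S.group t (S.φ k l) ∈ S.scale β) :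
    f ⟨S.group t (S.φ k l), h⟩ = ∑ j ∈ Finset.range (l + 1),
      expMonomial (S.freq k) (l - j) t • f ⟨S.φExt k j, S.φExt_mem_scale β k j⟩ := by
  have : (⟨S.group t (S.φ k l), h⟩ : S.scale β) = ∑ j ∈ Finset.range (l + 1),
      expMonomial (S.freq k) (l - j) t • ⟨S.φExt k j, S.φExt_mem_scale β k j⟩ := by
    apply Subtype.ext
    simp [S.group_φ, S.groupVec_eq_sum]
  rw [this]
  simp only [map_sum, map_smul]

end Exosystem

/-! ### The Sylvester equation and the convolution integral -/

section Closed

open MeasureTheory intervalIntegral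

variable {I W V : Type*} [NormedAddCommGroup W] [InnerProductSpace ℂ W] [CompleteSpace W]
  [NormedAddCommGroup V] [NormedSpace ℂ V]
  {T : C0Semigroup V} {A : V →ₗ.[ℂ] V} (S : Exosystem I W)

/-- `Sig` solves the Sylvester equation `Sig S = A Sig + Be`. -/
structure IsSylvesterSolution (α : ℝ) (A : V →ₗ.[ℂ] V) (Be : W →L[ℂ] V)
    (Sig : S.scale α →ₗ[ℂ] V) : Prop where
  bounded : ∃ M : ℝ, ∀ v : S.scale α, ‖Sig v‖ ≤ M * S.scaleNorm α v
  equation : ∀ v ∈ S.scale (α + 1), ∃ (hS : v ∈ S.op.domain) (hv : v ∈ S.scale α)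
      (hSv : S.op ⟨v, hS⟩ ∈ S.scale α) (hA : Sig ⟨v, hv⟩ ∈ A.domain),
      Sig ⟨S.op ⟨v, hS⟩, hSv⟩ = A ⟨Sig ⟨v, hv⟩, hA⟩ + Be v

variable {S} in
-- The Sylvester equation at a basis vector, solved for `A Σ φ`. It shows that `Σ` maps each block
-- to a Jordan chain in the form required by `integral_chain`.
theorem IsSylvesterSolution.mem_graph {α : ℝ} {Be : W →L[ℂ] V}
    {Sig : S.scale α →ₗ[ℂ] V} (h : IsSylvesterSolution S α A Be Sig) (k : I) (l : Fin (S.n k)) :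
    (Sig ⟨S.φExt k l, S.φExt_mem_scale α k l⟩,
      S.freq k • Sig ⟨S.φExt k l, S.φExt_mem_scale α k l⟩ +
        (if 0 < (l : ℕ) then Sig ⟨S.φExt k (l - 1), S.φExt_mem_scale α k (l - 1)⟩ else 0) -
        Be (S.φExt k l)) ∈ A.graph := by
  obtain ⟨hS, hv, hSv, hA, he⟩ := h.equation (S.φ k l) (S.φ_mem_scale _ k l)
  have e1 : (⟨S.op ⟨S.φ k l, hS⟩, hSv⟩ : S.scale α) =
      S.freq k • ⟨S.φExt k l, S.φExt_mem_scale α k l⟩ +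
        if 0 < (l : ℕ) then ⟨S.φExt k (l - 1), S.φExt_mem_scale α k (l - 1)⟩ else 0 := by
    apply Subtype.ext
    simp only [S.op_φ, S.blockVec_eq_φExt]
    split_ifs <;> rfl
  rw [e1, map_add, map_smul] at he
  have e2 : Sig (if 0 < (l : ℕ) then ⟨S.φExt k (l - 1), S.φExt_mem_scale α k (l - 1)⟩ else 0) =
      if 0 < (l : ℕ) then Sig ⟨S.φExt k (l - 1), S.φExt_mem_scale α k (l - 1)⟩ else 0 := by
    split_ifs <;> simp
  rw [e2] at he
  rw [he]
  simp only [S.φExt_coe, add_sub_cancel_right]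
  exact A.mem_graph ⟨Sig ⟨S.φ k l, hv⟩, hA⟩

variable [CompleteSpace V]

theorem continuousOn_convolution (T : C0Semigroup V) (Be : W →L[ℂ] V) (v : W) {t : ℝ} :
    ContinuousOn (fun s => T.toFun (t - s) (Be (S.group s v))) (Set.Icc 0 t) := by
  have hsub : ContinuousOn (fun s : ℝ => t - s) (Set.Icc 0 t) := by fun_prop
  have hmaps : Set.MapsTo (fun s : ℝ => t - s) (Set.Icc 0 t) (Set.Icc 0 t) := fun s hs =>
    ⟨by linarith [hs.2], by linarith [hs.1]⟩
  have h1 : ContinuousOn (fun s => Be (S.group (t - s) v)) (Set.Icc 0 t) :=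
    Be.continuous.comp_continuousOn ((S.continuousOn_group v t).comp hsub hmaps)
  have h2 := (T.continuousOn_apply_of_continuousOn h1).comp hsub hmaps
  simpa [Function.comp_def] using h2

theorem intervalIntegrable_convolution (T : C0Semigroup V) (Be : W →L[ℂ] V) (v : W) {t : ℝ}
    (ht : 0 ≤ t) :
    IntervalIntegrable (fun s => T.toFun (t - s) (Be (S.group s v))) volume 0 t := by
  refine ContinuousOn.intervalIntegrable ?_
  rw [Set.uIcc_of_le ht]
  exact continuousOn_convolution S T Be v

/-- The convolution `∫₀ᵗ T(t - s) B_e T_S(s) v ds` as a linear map of `v`. -/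
def convolution (T : C0Semigroup V) (Be : W →L[ℂ] V) {t : ℝ} (ht : 0 ≤ t) : W →ₗ[ℂ] V where
  toFun v := ∫ s in (0 : ℝ)..t, T.toFun (t - s) (Be (S.group s v))
  map_add' v w := by
    rw [← integral_add (intervalIntegrable_convolution S T Be v ht)
      (intervalIntegrable_convolution S T Be w ht)]
    simp only [S.group_add, map_add]
  map_smul' c v := by
    simp only [S.group_smul, map_smul, RingHom.id_apply, intervalIntegral.integral_smul]

theorem convolution_apply (T : C0Semigroup V) (Be : W →L[ℂ] V) {t : ℝ} (ht : 0 ≤ t) (v : W) :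
    convolution S T Be ht v = ∫ s in (0 : ℝ)..t, T.toFun (t - s) (Be (S.group s v)) := rfl

theorem exists_norm_convolution_le (T : C0Semigroup V) (Be : W →L[ℂ] V) {t : ℝ} (ht : 0 ≤ t) :
    ∃ M : ℝ, 0 ≤ M ∧ ∀ v, ‖convolution S T Be ht v‖ ≤ M * ‖v‖ := by
  obtain ⟨M, hM0, hM⟩ := T.exists_norm_le t
  refine ⟨M * ‖Be‖ * ((S.maxSize : ℝ) ^ 2 * Real.exp t) * t, by positivity, fun v => ?_⟩
  have h := norm_integral_le_of_norm_le_const (a := 0) (b := t)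
    (f := fun s => T.toFun (t - s) (Be (S.group s v)))
    (C := M * (‖Be‖ * (((S.maxSize : ℝ) ^ 2 * Real.exp t) * ‖v‖))) (fun s hs => by
      rw [Set.uIoc_of_le ht] at hs
      refine (ContinuousLinearMap.le_opNorm _ _).trans ?_
      gcongr
      · exact hM _ (by linarith [hs.2]) (by linarith [hs.1])
      · refine (Be.le_opNorm _).trans ?_
        gcongr
        refine (S.norm_group_le s v).trans ?_
        gcongr
        rw [abs_of_pos hs.1]
        exact hs.2)
  refine h.trans (le_of_eq ?_)
  rw [sub_zero, abs_of_nonneg ht]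
  ring

namespace IsSylvesterSolution

variable {S} {α : ℝ} {Be : W →L[ℂ] V} {Sig : S.scale α →ₗ[ℂ] V}

theorem convolution_φ (h : IsSylvesterSolution S α A Be Sig) (hT : T.IsGeneratedBy A) {t : ℝ}
    (ht : 0 ≤ t) (k : I) (l : Fin (S.n k)) :
    convolution S T Be ht (S.φ k l) =
      Sig ⟨S.group t (S.φ k l), S.group_mem_scale t (S.φ_mem_scale α k l)⟩ -
        T.toFun t (Sig ⟨S.φ k l, S.φ_mem_scale α k l⟩) := by
  have h1 := hT.integral_chain (S.freq k) (fun j => Sig ⟨S.φExt k j, S.φExt_mem_scale α k j⟩)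
    (fun j => Be (S.φExt k j)) l (fun j hj => h.mem_graph k ⟨j, by omega⟩) ht
  rw [S.map_group_φ]
  have e : (⟨S.φ k l, S.φ_mem_scale α k l⟩ : S.scale α) =
      ⟨S.φExt k l, S.φExt_mem_scale α k l⟩ := Subtype.ext (S.φExt_coe k l).symm
  rw [e, ← h1]
  change ∫ s in (0 : ℝ)..t, T.toFun (t - s) (Be (S.group s (S.φ k l))) = _
  -- Reversing time puts the convolution into the form of `integral_chain`.
  have h2 := intervalIntegral.integral_comp_sub_left (a := 0) (b := t)
    (fun s => T.toFun s (Be (S.group (t - s) (S.φ k l)))) t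
  simp only [sub_sub_cancel, sub_self, sub_zero] at h2
  rw [h2]
  simp only [S.group_φ, S.groupVec_eq_sum, map_sum, map_smul]

theorem convolution_eq (h : IsSylvesterSolution S α A Be Sig) (hα : 0 ≤ α)
    (hT : T.IsGeneratedBy A) {t : ℝ} (ht : 0 ≤ t) (v : S.scale α) :
    convolution S T Be ht v =
      Sig ⟨S.group t v, S.group_mem_scale t v.2⟩ - T.toFun t (Sig v) := by
  obtain ⟨M, hM⟩ := h.bounded
  obtain ⟨M', hM'0, hM'⟩ := exists_norm_convolution_le S T Be ht
  set Gt : S.scale α →ₗ[ℂ] S.scale α :=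
    (S.groupₗ t).restrict (fun v hv => S.group_mem_scale t hv) with hGt
  set f : S.scale α →ₗ[ℂ] V := (convolution S T Be ht).comp (S.scale α).subtype -
    (Sig.comp Gt - (T.toFun t).toLinearMap.comp Sig) with hf
  -- Both sides are bounded on `W_α`, the convolution because `α ≥ 0` makes `‖·‖_α` dominate the
  -- norm of `W`. Hence agreement at the basis vectors suffices.
  have hz := S.eq_zero_of_forall_φ f
    (M := M' + (|M| * ((S.maxSize : ℝ) ^ 2 * Real.exp |t|) + ‖T.toFun t‖ * |M|))
    (fun w => by
      have h0 := S.scaleNorm_nonneg α w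
      have hMa : ∀ v : S.scale α, ‖Sig v‖ ≤ |M| * S.scaleNorm α v := fun v =>
        (hM v).trans (by gcongr; exacts [S.scaleNorm_nonneg α v, le_abs_self M])
      have h1 : ‖convolution S T Be ht w‖ ≤ M' * S.scaleNorm α w :=
        (hM' w).trans (by gcongr; exact S.norm_le_scaleNorm hα w.2)
      have h2 : ‖Sig (Gt w)‖ ≤ |M| * ((S.maxSize : ℝ) ^ 2 * Real.exp |t|) * S.scaleNorm α w := by
        rw [mul_assoc]
        exact (hMa _).trans (by gcongr; exact S.scaleNorm_group_le t w.2)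
      have h3 : ‖T.toFun t (Sig w)‖ ≤ ‖T.toFun t‖ * |M| * S.scaleNorm α w := by
        rw [mul_assoc]
        exact ((T.toFun t).le_opNorm _).trans (by gcongr; exact hMa w)
      change ‖convolution S T Be ht w - (Sig (Gt w) - T.toFun t (Sig w))‖ ≤ _
      rw [add_mul, add_mul]
      exact (norm_sub_le _ _).trans (add_le_add h1 ((norm_sub_le _ _).trans (add_le_add h2 h3))))
    (fun k l => by
      change convolution S T Be ht (S.φ k l) -
        (Sig (Gt ⟨S.φ k l, S.φ_mem_scale α k l⟩) - T.toFun t (Sig _)) = 0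
      rw [sub_eq_zero]
      exact h.convolution_φ hT ht k l)
    v
  exact sub_eq_zero.1 hz

end IsSylvesterSolution

end Closed

/-! ### Regulation of the error and the Sylvester equation -/

section Regulation

variable {I W V Y : Type*} [NormedAddCommGroup W] [InnerProductSpace ℂ W] [CompleteSpace W]
  [NormedAddCommGroup V] [NormedSpace ℂ V]
  [NormedAddCommGroup Y] [NormedSpace ℂ Y]
  {T : C0Semigroup V} {A : V →ₗ.[ℂ] V} {Ce : V →ₗ.[ℂ] Y} {S : Exosystem I W}
  {α : ℝ} {Be : W →L[ℂ] V} {Sig : S.scale α →ₗ[ℂ] V}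

theorem RelativelyBounded.exists_bound (h : RelativelyBounded A Ce) :
    ∃ a b : ℝ, 0 ≤ a ∧ 0 ≤ b ∧ ∀ x ∈ A.domain, ‖pval Ce x‖ ≤ a * ‖x‖ + b * ‖pval A x‖ := by
  obtain ⟨a, b, hab⟩ := h.2
  refine ⟨|a|, |b|, abs_nonneg _, abs_nonneg _, fun x hx => (hab x hx).trans ?_⟩
  gcongr
  exacts [le_abs_self a, le_abs_self b]

/-- As `A T(t)x = T(t)Ax`, strong stability makes the orbit of a domain vector decay in the graph
norm, which controls `C_e`. -/
theorem RelativelyBounded.tendsto_zero (h : RelativelyBounded A Ce) (hT : T.IsGeneratedBy A)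
    (hS : T.StronglyStable) {x : V} (hx : x ∈ A.domain) :
    Tendsto (fun t => pval Ce (T.toFun t x)) atTop (𝓝 0) := by
  obtain ⟨a, b, -, -, hab⟩ := h.exists_bound
  have h1 := ((hS x).norm.const_mul a).add ((hS (pval A x)).norm.const_mul b)
  simp only [norm_zero, mul_zero, add_zero] at h1
  refine squeeze_zero_norm' ?_ h1
  filter_upwards [eventually_ge_atTop 0] with t ht
  rw [← hT.pval_map hx ht]
  exact hab _ (hT.map_mem_domain hx ht)

namespace IsSylvesterSolution

theorem mem_domain (h : IsSylvesterSolution S α A Be Sig) (v : S.scale (α + 1)) :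
    Sig (Submodule.inclusion (S.scale_add_one_le α) v) ∈ A.domain := by
  obtain ⟨hS, hv, hSv, hA, he⟩ := h.equation v v.2
  exact hA

/-- The operator `C_e Sig + F` on `W_{α+1}`. -/
def errorMap (h : IsSylvesterSolution S α A Be Sig) (hC : RelativelyBounded A Ce)
    (F : W →L[ℂ] Y) : S.scale (α + 1) →ₗ[ℂ] Y where
  toFun v := pval Ce (Sig (Submodule.inclusion (S.scale_add_one_le α) v)) + F v
  map_add' v w := by
    rw [map_add, map_add, pval_add Ce (hC.1 (h.mem_domain v)) (hC.1 (h.mem_domain w)),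
      Submodule.coe_add, map_add]
    abel
  map_smul' c v := by
    rw [map_smul, map_smul, pval_smul Ce c (hC.1 (h.mem_domain v)), SetLike.val_smul, map_smul,
      smul_add, RingHom.id_apply]

/-- `C_e Σ` is controlled by the graph norm of `A` along `Σ`, and `A Σ v = Σ S v - B_e v` involves
`S v`. This makes `C_e Σ + F` bounded on `W_{α+1}`, so its values at basis vectors determine it. -/
theorem errorMap_eq_zero (h : IsSylvesterSolution S α A Be Sig) (hα : 0 ≤ α)
    (hC : RelativelyBounded A Ce) (F : W →L[ℂ] Y)
    (h0 : ∀ k l, h.errorMap hC F ⟨S.φ k l, S.φ_mem_scale _ k l⟩ = 0) (v : S.scale (α + 1)) :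
    h.errorMap hC F v = 0 := by
  obtain ⟨a, b, ha, hb, hab⟩ := hC.exists_bound
  obtain ⟨M, hM⟩ := h.bounded
  obtain ⟨c, hc⟩ := S.scaleNorm_op_le (α := α)
  refine S.eq_zero_of_forall_φ (M := a * |M| + b * (|M| * c + ‖Be‖) + ‖F‖) _ (fun w => ?_) h0 v
  obtain ⟨hS, hv, hSv, hA, he⟩ := h.equation w w.2
  have hMa : ∀ v : S.scale α, ‖Sig v‖ ≤ |M| * S.scaleNorm α v := fun v =>
    (hM v).trans (by gcongr; exacts [S.scaleNorm_nonneg α v, le_abs_self M])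
  have hw : ‖(w : W)‖ ≤ S.scaleNorm (α + 1) w := S.norm_le_scaleNorm (by linarith) w.2
  have h1 : ‖Sig ⟨w, hv⟩‖ ≤ |M| * S.scaleNorm (α + 1) w :=
    (hMa _).trans (by gcongr; exact S.scaleNorm_mono (by linarith) w.2)
  have h2 : ‖Sig ⟨S.op ⟨w, hS⟩, hSv⟩‖ ≤ |M| * c * S.scaleNorm (α + 1) w := by
    rw [mul_assoc]
    exact (hMa _).trans (by gcongr; exact hc ⟨w, hS⟩ w.2)
  have h3 : ‖pval A (Sig ⟨w, hv⟩)‖ ≤ (|M| * c + ‖Be‖) * S.scaleNorm (α + 1) w := by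
    rw [pval_of_mem A hA, eq_sub_of_add_eq he.symm, add_mul]
    refine (norm_sub_le _ _).trans (add_le_add h2 ?_)
    exact (Be.le_opNorm _).trans (by gcongr)
  change ‖pval Ce (Sig ⟨w, hv⟩) + F w‖ ≤ _
  refine (norm_add_le _ _).trans ?_
  rw [add_mul]
  refine add_le_add ((hab _ hA).trans ?_) ((F.le_opNorm _).trans (by gcongr))
  rw [add_mul, mul_assoc, mul_assoc]
  gcongr

variable [CompleteSpace V]

/-- The splitting into a transient, driven by `x₀ - Σ v`, and the steady state `Σ T_S(t) v`. -/
theorem state_eq (h : IsSylvesterSolution S α A Be Sig) (hα : 0 ≤ α) (hT : T.IsGeneratedBy A)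
    (x₀ : V) (v : S.scale (α + 1)) {t : ℝ} (ht : 0 ≤ t) :
    T.toFun t x₀ + ∫ s in (0 : ℝ)..t, T.toFun (t - s) (Be (S.group s v)) =
      T.toFun t (x₀ - Sig (Submodule.inclusion (S.scale_add_one_le α) v)) +
        Sig (Submodule.inclusion (S.scale_add_one_le α)
          ⟨S.group t v, S.group_mem_scale t v.2⟩) := by
  have hincl : ∀ w : S.scale (α + 1), Submodule.inclusion (S.scale_add_one_le α) w =
      ⟨w, S.scale_add_one_le α w.2⟩ := fun _ => rfl
  have := h.convolution_eq hα hT ht ⟨v, S.scale_add_one_le α v.2⟩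
  rw [convolution_apply] at this
  rw [this, map_sub, hincl, hincl]
  abel

theorem state_mem_domain (h : IsSylvesterSolution S α A Be Sig) (hα : 0 ≤ α)
    (hT : T.IsGeneratedBy A) {x₀ : V} (hx : x₀ ∈ A.domain) (v : S.scale (α + 1)) {t : ℝ}
    (ht : 0 ≤ t) :
    T.toFun t x₀ + ∫ s in (0 : ℝ)..t, T.toFun (t - s) (Be (S.group s v)) ∈ A.domain := by
  rw [h.state_eq hα hT x₀ v ht]
  exact A.domain.add_mem (hT.map_mem_domain (A.domain.sub_mem hx (h.mem_domain v)) ht)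
    (h.mem_domain _)

theorem error_eq (h : IsSylvesterSolution S α A Be Sig) (hα : 0 ≤ α)
    (hC : RelativelyBounded A Ce) (F : W →L[ℂ] Y)
    (hT : T.IsGeneratedBy A) {x₀ : V} (hx : x₀ ∈ A.domain) (v : S.scale (α + 1)) {t : ℝ}
    (ht : 0 ≤ t) :
    pval Ce (T.toFun t x₀ + ∫ s in (0 : ℝ)..t, T.toFun (t - s) (Be (S.group s v))) +
        F (S.group t v) =
      pval Ce (T.toFun t (x₀ - Sig (Submodule.inclusion (S.scale_add_one_le α) v))) +
        h.errorMap hC F ⟨S.group t v, S.group_mem_scale t v.2⟩ := by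
  rw [h.state_eq hα hT x₀ v ht, pval_add Ce
    (hC.1 (hT.map_mem_domain (A.domain.sub_mem hx (h.mem_domain v)) ht))
    (hC.1 (h.mem_domain _)), add_assoc]
  rfl

/-- The error vanishes asymptotically if `C_e Sig + F` vanishes at the basis vectors. -/
theorem tendsto_error (h : IsSylvesterSolution S α A Be Sig) (hα : 0 ≤ α)
    (hC : RelativelyBounded A Ce) (F : W →L[ℂ] Y)
    (hT : T.IsGeneratedBy A) (hst : T.StronglyStable)
    (h0 : ∀ k l, h.errorMap hC F ⟨S.φ k l, S.φ_mem_scale _ k l⟩ = 0)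
    {x₀ : V} (hx : x₀ ∈ A.domain) (v : S.scale (α + 1)) :
    Tendsto (fun t : ℝ =>
      pval Ce (T.toFun t x₀ + ∫ s in (0 : ℝ)..t, T.toFun (t - s) (Be (S.group s v))) +
        F (S.group t v)) atTop (𝓝 0) := by
  refine (hC.tendsto_zero hT hst (A.domain.sub_mem hx (h.mem_domain v))).congr' ?_
  filter_upwards [eventually_ge_atTop 0] with t ht
  rw [h.error_eq hα hC F hT hx v ht, h.errorMap_eq_zero hα hC F h0, add_zero]

/-- If the error vanishes asymptotically for all initial data, then `C_e Sig + F` vanishes at the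
basis vectors. -/
theorem errorMap_φ_eq_zero (h : IsSylvesterSolution S α A Be Sig) (hα : 0 ≤ α)
    (hC : RelativelyBounded A Ce) (F : W →L[ℂ] Y) (hT : T.IsGeneratedBy A)
    (hlim : ∀ x₀ ∈ A.domain, ∀ v ∈ S.scale (α + 1), Tendsto (fun t : ℝ =>
      pval Ce (T.toFun t x₀ + ∫ s in (0 : ℝ)..t, T.toFun (t - s) (Be (S.group s v))) +
        F (S.group t v)) atTop (𝓝 0)) (k : I) (l : Fin (S.n k)) :
    h.errorMap hC F ⟨S.φ k l, S.φ_mem_scale _ k l⟩ = 0 := by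
  have h1 : ∀ v : S.scale (α + 1), Tendsto (fun t : ℝ =>
      h.errorMap hC F ⟨S.group t v, S.group_mem_scale t v.2⟩) atTop (𝓝 0) := by
    intro v
    -- The initial state `Σ v` removes the transient, so the error is exactly the steady-state term.
    refine (hlim _ (h.mem_domain v) v v.2).congr' ?_
    filter_upwards [eventually_ge_atTop 0] with t ht
    rw [h.error_eq hα hC F hT (h.mem_domain v) v ht, sub_self, map_zero,
      pval_of_mem Ce Ce.domain.zero_mem]
    exact (congrArg (· + _) Ce.map_zero).trans (zero_add _)
  have key : ∀ m (hm : m < S.n k),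
      h.errorMap hC F ⟨S.φExt k m, S.φExt_mem_scale _ k m⟩ = 0 := by
    intro m
    induction m using Nat.strong_induction_on with
    | _ m ih =>
      intro hm
      have h2 := (h1 ⟨S.φ k ⟨m, hm⟩, S.φ_mem_scale _ k _⟩).norm
      simp only [S.map_group_φ] at h2
      rw [norm_zero] at h2
      -- By the induction hypothesis only the top term of the sum survives. Its scalar factor
      -- `e^{iωt}` has modulus one, so a function of constant norm tends to zero.
      refine norm_eq_zero.1 (tendsto_nhds_unique (tendsto_const_nhds.congr fun t => ?_) h2)
      rw [Finset.sum_range_succ, Finset.sum_eq_zero, zero_add, norm_smul, Nat.sub_self,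
        norm_expMonomial_zero (by simp [Exosystem.freq]), one_mul]
      intro j hj
      have hj := Finset.mem_range.1 hj
      rw [ih j hj (hj.trans hm), smul_zero]
  have := key l l.2
  simpa only [S.φExt_coe] using this

end IsSylvesterSolution

end Regulation

/-! ### Jordan chains -/

/-- The next entry of a vector, and `0` after the last one. -/
def next {V : Type*} [Zero V] {n : ℕ} (x : Fin n → V) (i : Fin n) : V :=
  if h : (i : ℕ) + 1 < n then x ⟨i + 1, h⟩ else 0

/-- Back substitution for an upper bidiagonal system: induction downwards from the last entry, whose
successor is zero by convention. -/
theorem eq_of_next_recursion {V : Type*} [Zero V] {n : ℕ} {x y : Fin n → V}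
    (h : ∀ i, next x i = next y i → x i = y i) : x = y := by
  have key : ∀ m, ∀ i : Fin n, n - (i : ℕ) = m → x i = y i := by
    intro m
    induction m using Nat.strong_induction_on with
    | _ m ih =>
      intro i hi
      refine h i ?_
      unfold next
      split_ifs with hn
      · exact ih (n - (i + 1)) (by omega) ⟨i + 1, hn⟩ rfl
      · rfl
  exact funext fun i => key _ i rfl

/-- After the diagonal term is split off, every remaining summand of row `i` is `-R` of the
corresponding summand of row `i + 1`. Hence these block matrices invert bidiagonal systems. -/
theorem blockUpper_eq {V V' : Type*} [AddCommGroup V'] (c : ℕ → V → V') (R : V' →+ V')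
    (hc : ∀ m y, c (m + 1) y = R (c m y)) (n : ℕ) (x : Fin n → V) (i : Fin n) :
    blockUpper c n x i = c 0 (x i) - R (next (blockUpper c n x) i) := by
  unfold next
  split_ifs with h
  · have e : Finset.Ici i = insert i (Finset.Ici (⟨i + 1, h⟩ : Fin n)) := by
      ext j
      simp only [Finset.mem_Ici, Finset.mem_insert, Fin.le_def, Fin.ext_iff]
      omega
    rw [blockUpper, e, Finset.sum_insert (by simp [Fin.le_def])]
    rw [blockUpper, map_sum, sub_eq_add_neg, ← Finset.sum_neg_distrib]
    congr 1
    · simp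
    · refine Finset.sum_congr rfl fun j hj => ?_
      have hj : (i : ℕ) + 1 ≤ j := Fin.le_def.1 (Finset.mem_Ici.1 hj)
      have : (j : ℕ) - i = (j - (i + 1)) + 1 := by omega
      simp only [this, hc, pow_succ, map_zsmul, mul_neg, mul_one, neg_smul]
  · have e : Finset.Ici i = {i} := by
      ext j
      simp only [Finset.mem_Ici, Finset.mem_singleton, Fin.le_def, Fin.ext_iff]
      omega
    rw [blockUpper, e]
    simp

theorem next_add {V : Type*} [AddZeroClass V] {n : ℕ} (x y : Fin n → V) (i : Fin n) :
    next (fun j => x j + y j) i = next x i + next y i := by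
  unfold next
  split_ifs <;> simp

theorem blockUpper_mem {V V' : Type*} [AddCommGroup V'] (c : ℕ → V → V') (p : AddSubgroup V')
    (n : ℕ) (x : Fin n → V) (hc : ∀ m j, c m (x j) ∈ p) (i : Fin n) : blockUpper c n x i ∈ p :=
  sum_mem fun _ _ => zsmul_mem (hc _ _) _

section Chains

variable {X : Type*} [NormedAddCommGroup X] [NormedSpace ℂ X] [CompleteSpace X]
  {A : X →ₗ.[ℂ] X} {lam mu : ℂ}

theorem add_eq_add_sub_iff {V : Type*} [AddCommGroup V] {a b c d e : V} :
    a + b = c + d - e ↔ b + e - d = c - a := by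
  rw [eq_sub_iff_add_eq, sub_eq_iff_eq_add, ← sub_eq_zero, ← sub_eq_zero (a := b + e)]
  abel_nf

/-- Once the successors agree, the difference of two entries is an eigenvector at `iω`, hence zero.
-/
theorem C0Semigroup.StronglyStable.chain_unique {T : C0Semigroup X} (hS : T.StronglyStable)
    (hT : T.IsGeneratedBy A) {w : ℝ} {n : ℕ} {b x y : Fin n → X}
    (hx : ∀ i, (x i, (Complex.I * (w : ℂ)) • x i + next x i - b i) ∈ A.graph)
    (hy : ∀ i, (y i, (Complex.I * (w : ℂ)) • y i + next y i - b i) ∈ A.graph) : x = y := by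
  refine eq_of_next_recursion fun i hi => ?_
  refine sub_eq_zero.1 (hS.eigenvector_eq_zero hT (w := w) ?_)
  convert A.graph.sub_mem (hx i) (hy i) using 1
  rw [Prod.mk_sub_mk, hi]
  congr 1
  module

/-- The solution of a block bidiagonal system with the extended generator. -/
theorem eq_block_iff (hA : Dense (A.domain : Set X)) (h : lam ∈ resolventSet A)
    (hm : mu ∈ resolventSet A) {n : ℕ} (b : Fin n → Extrapolation A lam) (e : Fin n → X)
    (x : Fin n → X) :
    (x = fun i => blockExtendedResolvent A lam mu n b i + blockResolvent A mu n e i) ↔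
      ∀ i, extendedGenerator A lam (x i) + b i =
        embed A lam (mu • x i + next x i - e i) := by
  have h1 := fun i => blockUpper_eq (fun m => extendedResolventPow A lam mu m)
    (resolvent A mu : X →+ X) (fun m y => extendedResolventPow_succ hA h hm m y) n b i
  have h2 := fun i => blockUpper_eq (fun m => ((resolvent A mu) ^ (m + 1) : X →L[ℂ] X))
    (resolvent A mu : X →+ X) (fun m y => by rw [pow_succ' _ (m + 1)]; rfl) n e i
  -- Applying `R(mu, A₋₁)` turns each row into a recursion that expresses `x i` through its
  -- successor.
  have h3 : ∀ (x : Fin n → X) i, (extendedGenerator A lam (x i) + b i =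
      embed A lam (mu • x i + next x i - e i)) ↔
      x i = extendedResolvent A lam mu (b i) + resolvent A mu (e i) - resolvent A mu (next x i) := by
    intro x i
    rw [← extendedResolvent_embed hA h hm, ← extendedResolvent_embed hA h hm (next x i),
      ← map_add, ← map_sub, eq_comm (a := x i), extendedResolvent_eq_iff hA h hm]
    rw [(embed A lam).map_sub, (embed A lam).map_add, (embed A lam).map_smul]
    exact add_eq_add_sub_iff
  -- The block resolvents satisfy the same recursion, which has only one solution.
  have h4 : ∀ i, blockExtendedResolvent A lam mu n b i + blockResolvent A mu n e i =
      extendedResolvent A lam mu (b i) + resolvent A mu (e i) - resolvent A mu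
        (next (fun i => blockExtendedResolvent A lam mu n b i + blockResolvent A mu n e i) i) := by
    intro i
    rw [next_add, map_add]
    refine (congrArg₂ (· + ·) (h1 i) (h2 i)).trans ?_
    simp only [extendedResolventPow_zero, zero_add, pow_one]
    change _ - resolvent A mu (next (blockExtendedResolvent A lam mu n b) i) +
      (_ - resolvent A mu (next (blockResolvent A mu n e) i)) = _
    abel
  simp only [h3]
  constructor
  · intro hx i
    rw [hx]
    exact h4 i
  · intro hx
    refine eq_of_next_recursion fun i hi => ?_
    rw [hx i, hi]
    exact (h4 i).symm

end Chains

/-! ### The closed-loop system and the block equations -/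

theorem next_prod {X Z : Type*} [Zero X] [Zero Z] {n : ℕ} (x : Fin n → X) (z : Fin n → Z) (i : Fin n) :
    next (fun j => (x j, z j)) i = (next x i, next z i) := by
  unfold next
  split_ifs <;> rfl

section ClosedLoop

variable {X Z U Y W I : Type*}
  [NormedAddCommGroup X] [NormedSpace ℂ X]
  [NormedAddCommGroup Z] [NormedSpace ℂ Z]
  [NormedAddCommGroup U] [NormedSpace ℂ U]
  [NormedAddCommGroup Y] [NormedSpace ℂ Y]
  [NormedAddCommGroup W] [InnerProductSpace ℂ W]
  {P : Plant X U Y} {G : Controller Z U Y}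

/-- Passing from the relation to an operator preserves the graph only if the relation is
single-valued; this rests on the injectivity of `X → X₋₁`. -/
theorem graph_closedLoopA (h : P.lam ∈ resolventSet P.A) :
    (closedLoopA P G).graph = closedLoopGraph P G := by
  refine Submodule.toLinearPMap_graph_eq _ ?_
  rintro ⟨p, w, q⟩ ⟨x, z, h1, h2, h3⟩ h0
  have hx : (x : X) = 0 ∧ (z : Z) = 0 := by
    have := h1.symm.trans h0
    simpa using this
  obtain rfl : x = 0 := Subtype.ext hx.1
  obtain rfl : z = 0 := Subtype.ext hx.2
  simp only [map_zero, LinearPMap.map_zero, add_zero, Submodule.coe_zero] at h2 h3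
  have hw : w = 0 := embed_injective h (by rw [map_zero]; exact h2.symm)
  rw [hw, h3]
  rfl

theorem mem_graph_closedLoopA (h : P.lam ∈ resolventSet P.A) {x w : X} {z q : Z} :
    ((x, z), (w, q)) ∈ (closedLoopA P G).graph ↔
      ∃ (hx : x ∈ P.C.domain) (hz : z ∈ G.G₁.domain),
        extendedGenerator P.A P.lam x + P.B (G.KOnDom ⟨z, hz⟩) = embed P.A P.lam w ∧
        q = G.G₂ (P.C ⟨x, hx⟩) + (G.G₁ ⟨z, hz⟩ + G.G₂ (P.D (G.KOnDom ⟨z, hz⟩))) := by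
  rw [graph_closedLoopA h]
  constructor
  · rintro ⟨⟨x', hx⟩, ⟨z', hz⟩, h1, h2, h3⟩
    obtain ⟨rfl, rfl⟩ := Prod.mk.inj h1
    exact ⟨hx, hz, h2, h3⟩
  · rintro ⟨hx, hz, h2, h3⟩
    exact ⟨⟨x, hx⟩, ⟨z, hz⟩, rfl, h2, h3⟩

theorem pval_closedLoopC {x : X} {z : Z} (hx : x ∈ P.C.domain) (hz : z ∈ G.G₁.domain) :
    pval (closedLoopC P G) (x, z) = pval P.C x + P.D (G.KOnDom ⟨z, hz⟩) := by
  have h : (x, z) ∈ (closedLoopC P G).domain := ⟨hx, G.dom_le hz⟩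
  rw [pval_of_mem _ h, pval_of_mem _ hx]
  exact LinearPMap.coprod_apply _ _ _

variable {mu : ℂ}

theorem Plant.IsAdmissible.blockResolvent_mem (hP : P.IsAdmissible)
    (hm : mu ∈ resolventSet P.A) {n : ℕ} (e : Fin n → X) (i : Fin n) :
    blockResolvent P.A mu n e i ∈ P.C.domain := by
  refine blockUpper_mem _ P.C.domain.toAddSubgroup n _ (fun m j => ?_) i
  refine hP.output_bounded.1 ?_
  rw [pow_succ']
  exact resolvent_mem_domain hm _

theorem jordanOp_eq (G₁ : Z →ₗ.[ℂ] Z) (mu : ℂ) (n : ℕ) (z : Fin n → G₁.domain) (i : Fin n) :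
    jordanOp G₁ mu n z i = mu • (z i : Z) - G₁ (z i) + next (fun j => (z j : Z)) i := rfl

variable [CompleteSpace X]

theorem Plant.IsAdmissible.dense_domain (hP : P.IsAdmissible) : Dense (P.A.domain : Set X) := by
  obtain ⟨T, hT⟩ := hP.generates
  exact hT.dense_domain

theorem Plant.IsAdmissible.extendedResolvent_mem (hP : P.IsAdmissible)
    (hm : mu ∈ resolventSet P.A) (u : U) :
    extendedResolvent P.A P.lam mu (P.B u) ∈ P.C.domain := by
  obtain ⟨nu, hn, h, -⟩ := hP.transfer_bounded
  have := hP.output_bounded.1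
    (extendedResolvent_sub_mem_domain hP.dense_domain hP.lam_mem hm hn (P.B u))
  simpa using P.C.domain.add_mem this (h u)

/-- Only the diagonal entries need the admissibility of `B` and `C`; higher powers of the resolvent
already map into `Dom(A)`. -/
theorem Plant.IsAdmissible.blockExtendedResolvent_mem (hP : P.IsAdmissible)
    (hm : mu ∈ resolventSet P.A) {n : ℕ} (u : Fin n → U) (i : Fin n) :
    blockExtendedResolvent P.A P.lam mu n (fun j => P.B (u j)) i ∈ P.C.domain := by
  refine blockUpper_mem _ P.C.domain.toAddSubgroup n _ (fun m j => ?_) i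
  rcases m with _ | m
  · exact hP.extendedResolvent_mem hm (u j)
  · rw [extendedResolventPow_succ hP.dense_domain hP.lam_mem hm]
    exact hP.output_bounded.1 (resolvent_mem_domain hm _)

variable {S : Exosystem I W} {E : W →L[ℂ] X} {F : W →L[ℂ] Y} {k : I}

/-- A solution of the block equations yields a Jordan chain of the closed-loop system along which
the regulation error vanishes. -/
theorem SolvesBlockEquations.exists_chain (hP : P.IsAdmissible)
    (hm : S.freq k ∈ resolventSet P.A) {z : Fin (S.n k) → G.G₁.domain}
    (hz : SolvesBlockEquations S G P E F k z) :
    ∃ x : Fin (S.n k) → X,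
      (∀ i, ((x i, (z i : Z)), S.freq k • (x i, (z i : Z)) + next (fun j => (x j, (z j : Z))) i -
        closedLoopB G E F (S.Φ k i)) ∈ (closedLoopA P G).graph) ∧
      ∀ i, pval (closedLoopC P G) (x i, (z i : Z)) + F (S.Φ k i) = 0 := by
  set b : Fin (S.n k) → Extrapolation P.A P.lam := fun j => P.B (G.KOnDom (z j)) with hb
  set e : Fin (S.n k) → X := fun j => E (S.Φ k j) with he
  set x : Fin (S.n k) → X := fun i => blockExtendedResolvent P.A P.lam (S.freq k) (S.n k) b i +
    blockResolvent P.A (S.freq k) (S.n k) e i with hx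
  have hx1 := hP.blockExtendedResolvent_mem hm (fun j => G.KOnDom (z j))
  have hx2 := hP.blockResolvent_mem hm e
  have hxC : ∀ i, x i ∈ P.C.domain := fun i => P.C.domain.add_mem (hx1 i) (hx2 i)
  have hxb := (eq_block_iff hP.dense_domain hP.lam_mem hm b e x).1 hx
  -- For this choice of `x`, the first block equation says exactly that the error vanishes along the
  -- chain.
  have herr : ∀ i, pval P.C (x i) + P.D (G.KOnDom (z i)) + F (S.Φ k i) = 0 := by
    intro i
    have h1 := hz.1 i
    rw [blockTransfer] at h1
    rw [hx]
    simp only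
    rw [pval_add P.C (hx1 i) (hx2 i), add_right_comm (pval P.C _), h1]
    abel
  refine ⟨x, fun i => ?_, fun i => ?_⟩
  · rw [next_prod]
    change ((x i, (z i : Z)), (S.freq k • x i + next x i - e i,
      S.freq k • (z i : Z) + next (fun j => (z j : Z)) i - G.G₂ (F (S.Φ k i)))) ∈ _
    rw [mem_graph_closedLoopA hP.lam_mem]
    refine ⟨hxC i, (z i).2, hxb i, ?_⟩
    have h2 := hz.2 i
    rw [jordanOp_eq] at h2
    have h3 := congrArg G.G₂ (herr i)
    rw [pval_of_mem _ (hxC i), map_add, map_add, map_zero] at h3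
    have h4 : S.freq k • (z i : Z) + next (fun j => (z j : Z)) i = G.G₁ (z i) := by
      rw [← sub_eq_zero, ← h2]; abel
    -- The controller row differs from `J_G z = 0` only by `G₂` applied to the error, which is zero.
    rw [h4, eq_comm, ← sub_eq_zero, ← h3]
    abel
  · rw [pval_closedLoopC (hxC i) (z i).2]
    exact herr i

/-- A Jordan chain of the closed-loop system along which the regulation error vanishes yields a
solution of the block equations. -/
theorem SolvesBlockEquations.of_chain (hP : P.IsAdmissible)
    (hm : S.freq k ∈ resolventSet P.A) {h : Fin (S.n k) → X × Z}
    (hg : ∀ i, (h i, S.freq k • h i + next h i - closedLoopB G E F (S.Φ k i)) ∈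
      (closedLoopA P G).graph)
    (h0 : ∀ i, pval (closedLoopC P G) (h i) + F (S.Φ k i) = 0) :
    ∃ z : Fin (S.n k) → G.G₁.domain, SolvesBlockEquations S G P E F k z := by
  set x : Fin (S.n k) → X := fun i => (h i).1 with hx
  have hn : ∀ i, next h i = (next x i, next (fun j => (h j).2) i) := fun i =>
    next_prod (fun j => (h j).1) (fun j => (h j).2) i
  have hg' : ∀ i, ((x i, (h i).2), (S.freq k • x i + next x i - E (S.Φ k i),
      S.freq k • (h i).2 + next (fun j => (h j).2) i - G.G₂ (F (S.Φ k i)))) ∈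
      (closedLoopA P G).graph := by
    intro i
    have := hg i
    rw [hn] at this
    exact this
  simp only [mem_graph_closedLoopA hP.lam_mem] at hg'
  choose hxC hz h1 h2 using hg'
  set z : Fin (S.n k) → G.G₁.domain := fun i => ⟨(h i).2, hz i⟩ with hzdef
  have herr : ∀ i, pval P.C (x i) + P.D (G.KOnDom (z i)) + F (S.Φ k i) = 0 := by
    intro i
    rw [← pval_closedLoopC (hxC i) (hz i)]
    exact h0 i
  refine ⟨z, fun i => ?_, fun i => ?_⟩
  · have hxb := congrFun ((eq_block_iff hP.dense_domain hP.lam_mem hm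
      (fun j => P.B (G.KOnDom (z j))) (fun j => E (S.Φ k j)) x).2 h1) i
    have h3 := herr i
    rw [hxb, pval_add P.C (hP.blockExtendedResolvent_mem hm _ i)
      (hP.blockResolvent_mem hm _ i)] at h3
    rw [blockTransfer, ← sub_eq_zero, ← h3]
    abel
  · have h3 := congrArg G.G₂ (herr i)
    rw [pval_of_mem _ (hxC i), map_add, map_add, map_zero] at h3
    rw [jordanOp_eq]
    have h4 := sub_eq_zero.2 (h2 i)
    -- Adding `G₂` of the vanishing error cancels the plant output in the controller row and leaves
    -- `J_G z = 0`.
    have h5 := congrArg₂ (· + ·) h4 h3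
    simp only [add_zero] at h5
    rw [← h5]
    simp only [hzdef]
    abel

end ClosedLoop

/-- `Φ_k` lists the block in reverse order, so the predecessor `φ^{l-1}` in the Jordan relation
becomes the next entry. -/
theorem IsSylvesterSolution.mem_graph_Φ {I W V : Type*}
    [NormedAddCommGroup W] [InnerProductSpace ℂ W] [CompleteSpace W]
    [NormedAddCommGroup V] [NormedSpace ℂ V]
    {A : V →ₗ.[ℂ] V} {S : Exosystem I W} {α : ℝ} {Be : W →L[ℂ] V} {Sig : S.scale α →ₗ[ℂ] V}
    (h : IsSylvesterSolution S α A Be Sig) (k : I) (i : Fin (S.n k)) :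
    (Sig ⟨S.Φ k i, S.φ_mem_scale α k i.rev⟩,
      S.freq k • Sig ⟨S.Φ k i, S.φ_mem_scale α k i.rev⟩ +
        next (fun i => Sig ⟨S.Φ k i, S.φ_mem_scale α k i.rev⟩) i - Be (S.Φ k i)) ∈ A.graph := by
  have h1 := h.mem_graph k i.rev
  have e : (if 0 < (i.rev : ℕ) then
        Sig ⟨S.φExt k (i.rev - 1), S.φExt_mem_scale α k (i.rev - 1)⟩ else 0) =
      next (fun i => Sig ⟨S.Φ k i, S.φ_mem_scale α k i.rev⟩) i := by
    unfold next
    have hi := Fin.val_rev i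
    by_cases hn : (i : ℕ) + 1 < S.n k
    · rw [if_pos (by omega), dif_pos hn]
      congr 2
      rw [Exosystem.Φ, ← S.φExt_coe]
      congr 1
    · rw [if_neg (by omega), dif_neg hn]
  rw [e] at h1
  simp only [S.φExt_coe] at h1
  exact h1

end

end OutputRegulation

/-! ### The characterisation of robustness -/

open OutputRegulation in
theorem mainTheorem3
    {X Z U Y W I : Type*}
    [NormedAddCommGroup X] [NormedSpace ℂ X] [CompleteSpace X]
    [NormedAddCommGroup Z] [NormedSpace ℂ Z] [CompleteSpace Z]
    [NormedAddCommGroup U] [NormedSpace ℂ U] [CompleteSpace U]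
    [NormedAddCommGroup Y] [NormedSpace ℂ Y] [CompleteSpace Y]
    [NormedAddCommGroup W] [InnerProductSpace ℂ W] [CompleteSpace W]
    [Countable I]
    (S : OutputRegulation.Exosystem I W) (α : ℝ) (hα : 0 ≤ α)
    (P : OutputRegulation.Plant X U Y) (E : W →L[ℂ] X) (F : W →L[ℂ] Y)
    (G : OutputRegulation.Controller Z U Y)
    (hP : P.IsAdmissible) (hG : G.IsAdmissible)
    (hPG : OutputRegulation.ClosedLoopWellPosed P G)
    (hORP : OutputRegulation.SolvesOutputRegulation S α P E F G)
    (P' : OutputRegulation.Plant X U Y) (E' : W →L[ℂ] X) (F' : W →L[ℂ] Y)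
    (hO : OutputRegulation.IsInPerturbationClass S α G P' E' F') :
    (OutputRegulation.RobustWithRespectTo S α G P' E' F' ↔
      ∀ k : I, ∃ z : Fin (S.n k) → G.G₁.domain,
        OutputRegulation.SolvesBlockEquations S G P' E' F' k z) ∧
    (∀ (k : I) (z z' : Fin (S.n k) → G.G₁.domain),
      OutputRegulation.SolvesBlockEquations S G P' E' F' k z →
      OutputRegulation.SolvesBlockEquations S G P' E' F' k z' → z = z') := by
  obtain ⟨T, hT, hst⟩ := hO.closedLoop_stable
  have hC := hO.output_bounded
  obtain ⟨Sig, hb, heq⟩ := hO.sylvester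
  have hS : IsSylvesterSolution S α (closedLoopA P' G) (closedLoopB G E' F') Sig := ⟨hb, heq⟩
  have hA := hO.plant_admissible
  -- The chain built from a solution `z` must coincide with `Σ Φ_k`. This determines `z`, and it
  -- shows that the error vanishes along `Σ Φ_k`.
  have hchain : ∀ k (z : Fin (S.n k) → G.G₁.domain), SolvesBlockEquations S G P' E' F' k z →
      ∀ i, (Sig ⟨S.Φ k i, S.φ_mem_scale α k i.rev⟩).2 = z i ∧
        pval (closedLoopC P' G) (Sig ⟨S.Φ k i, S.φ_mem_scale α k i.rev⟩) + F' (S.Φ k i) = 0 := by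
    intro k z hz i
    obtain ⟨x, hx, hx0⟩ := hz.exists_chain hA (hO.freq_mem k)
    have := congrFun (hst.chain_unique hT hx (fun i => hS.mem_graph_Φ k i)) i
    rw [← this]
    exact ⟨rfl, hx0 i⟩
  refine ⟨⟨?_, ?_⟩, ?_⟩
  · rintro ⟨T', hT', hlim⟩ k
    refine SolvesBlockEquations.of_chain hA (hO.freq_mem k) (fun i => hS.mem_graph_Φ k i)
      fun i => ?_
    exact hS.errorMap_φ_eq_zero hα hC F' hT' (fun x hx v hv => (hlim x hx v hv).2) k i.rev
  · intro hz
    refine ⟨T, hT, fun x hx v hv => ⟨fun t ht => ?_, ?_⟩⟩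
    · exact hC.1 (hS.state_mem_domain hα hT hx ⟨v, hv⟩ ht)
    · refine hS.tendsto_error hα hC F' hT hst (fun k l => ?_) hx ⟨v, hv⟩
      obtain ⟨z, hz⟩ := hz k
      have := (hchain k z hz l.rev).2
      simp only [Exosystem.Φ, Fin.rev_rev] at this
      exact this
  · intro k z z' hz hz'
    exact funext fun i => Subtype.ext
      ((hchain k z hz i).1.symm.trans (hchain k z' hz' i).1)
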